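/- Let $X$ be a proper geodesic metric space. A proper ray in a metric space $Y$ with base point $y_0$ is a continuous map $\gamma:[0,\infty)\to Y$ such that $\gamma^{-1}(B(y_0,r))$ is bounded for every $r\ge 0$, where $B(y_0,r)$ is the closed ball. Two proper rays $\gamma_1,\gamma_2$ converge to the same end if for every $r\ge 0$ there is $t\ge 0$ such that $\gamma_1([t,\infty))$ and $\gamma_2([t,\infty))$ are contained in the same path component of $Y\setminus B(y_0,r)$. The space $\mathrm{Ends}(Y)$ is the set of equivalence classes $\mathrm{end}(\gamma)$ of proper rays $\gamma$. A sequence $\mathrm{end}(\gamma_n)$ converges to $\mathrm{end}(\gamma)$ if for every $r\ge 0$ there are numbers $N_n\ge 0$ such that, for all sufficiently large $n$, $\gamma_n([N_n,\infty))$ and $\gamma([N_n,\infty))$ are contained in the same path component of $Y\setminus B(y_0,r)$; a subset of $\mathrm{Ends}(Y)$ is closed if and only if it contains every limit of every convergent sequence of its elements. A simplicial tree is a connected simplicial complex of dimension at most $1$ that is an $\mathbb{R}$-tree for the path metric in which every edge is isometric to $[0,1]$; here an $\mathbb{R}$-tree is a metric space in which any two points are joined by a topologically embedded interval that is unique up to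 reparametrisation and is a geodesic. It is locally finite if every vertex has finitely many neighbours. Then there exists a locally finite simplicial tree $T$ such that, for every choice of base points in $X$ and in $T$, $\mathrm{Ends}(X)$ is homeomorphic to $\mathrm{Ends}(T)$. -/

import Mathlib

open Set Filter Topology Metric
open scoped NNReal

universe u v

/-- `α` restricted to `[0, dist x y]` is a geodesic from `x` to `y`. -/
def IsGeodesicFromTo {X : Type u} [MetricSpace X] (α : ℝ → X) (x y : X) : Prop :=
  α 0 = x ∧ α (dist x y) = y ∧
    ∀ s ∈ Icc (0 : ℝ) (dist x y), ∀ t ∈ Icc (0 : ℝ) (dist x y), dist (α s) (α t) = |s - t|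

/-- A geodesic metric space: any two points are joined by a geodesic. -/
def IsGeodesicSpace (X : Type u) [MetricSpace X] : Prop :=
  ∀ x y : X, ∃ α : ℝ → X, IsGeodesicFromTo α x y

/-- An `ℝ`-tree: any two points are joined by a topologically embedded interval, which is unique
(up to reparametrisation, that is, as a subset), and it is a geodesic. -/
def IsRTree (T : Type u) [MetricSpace T] : Prop :=
  ∀ x y : T, ∃ α : ℝ → T, IsGeodesicFromTo α x y ∧
    ∀ (r : ℝ) (β : ℝ → T), 0 ≤ r → β 0 = x → β r = y →
      IsEmbedding ((Icc (0 : ℝ) r).domRestrict β) →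
        β '' Icc (0 : ℝ) r = α '' Icc (0 : ℝ) (dist x y)

/-! ### The space of ends of a metric space with a base point -/

section Ends

variable {X : Type u} [MetricSpace X]

/-- A proper ray: a continuous map `[0, ∞) → X` such that the preimage of every closed ball around
the base point is bounded. -/
structure ProperRay (X : Type u) [MetricSpace X] (x₀ : X) where
  toFun : ℝ≥0 → X
  continuous_toFun : Continuous toFun
  isBounded_preimage : ∀ r : ℝ, 0 ≤ r → Bornology.IsBounded (toFun ⁻¹' closedBall x₀ r)

/-- The sets `A` and `B` are contained in the same path component of the complement of the closed
ball of radius `r` around `x₀`. -/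
def InSamePathComponent (x₀ : X) (r : ℝ) (A B : Set X) : Prop :=
  ∃ z ∈ (closedBall x₀ r)ᶜ,
    A ⊆ pathComponentIn (closedBall x₀ r)ᶜ z ∧ B ⊆ pathComponentIn (closedBall x₀ r)ᶜ z

theorem pathComponentIn_eq_of_mem_both {F : Set X} {z w a : X}
    (hz : a ∈ pathComponentIn F z) (hw : a ∈ pathComponentIn F w) :
    pathComponentIn F z = pathComponentIn F w := by
  have h : JoinedIn F z w := JoinedIn.trans hz (JoinedIn.symm hw)
  ext b
  exact ⟨fun hb => h.symm.trans hb, fun hb => h.trans hb⟩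

/-- Two proper rays converge to the same end. -/
def ProperRay.SameEnd {x₀ : X} (γ₁ γ₂ : ProperRay X x₀) : Prop :=
  ∀ r : ℝ, 0 ≤ r → ∃ t : ℝ≥0,
    InSamePathComponent x₀ r (γ₁.toFun '' Ici t) (γ₂.toFun '' Ici t)

theorem ProperRay.exists_tail {x₀ : X} (γ : ProperRay X x₀) (r : ℝ) (hr : 0 ≤ r) :
    ∃ t : ℝ≥0, ∀ s, t ≤ s → γ.toFun s ∈ (closedBall x₀ r)ᶜ := by
  obtain ⟨C, hC⟩ := (γ.isBounded_preimage r hr).subset_closedBall (0 : ℝ≥0)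
  refine ⟨(C + 1).toNNReal, fun s hs hmem => ?_⟩
  have h1 := hC hmem
  rw [mem_closedBall, NNReal.dist_eq] at h1
  have h2 : C + 1 ≤ (s : ℝ) := Real.toNNReal_le_iff_le_coe.1 hs
  have h3 := le_abs_self ((s : ℝ) - ((0 : ℝ≥0) : ℝ))
  simp only [NNReal.coe_zero, sub_zero] at h1 h3
  linarith

theorem ProperRay.SameEnd.refl {x₀ : X} (γ : ProperRay X x₀) : γ.SameEnd γ := by
  intro r hr
  obtain ⟨t, ht⟩ := γ.exists_tail r hr
  have key : γ.toFun '' Ici t ⊆ pathComponentIn (closedBall x₀ r)ᶜ (γ.toFun t) := by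
    have hpc : IsPathConnected (γ.toFun '' Ici t) := by
      have h : IsPathConnected (Ici t) := by
        have h0 : (fun x : ℝ => x.toNNReal) '' Ici (t : ℝ) = Ici t := by
          ext s
          simp only [mem_image, mem_Ici]
          constructor
          · rintro ⟨x, hx, rfl⟩
            exact NNReal.le_toNNReal_of_coe_le hx
          · intro hs
            exact ⟨s, NNReal.coe_le_coe.2 hs, Real.toNNReal_coe⟩
        rw [← h0]
        exact ((convex_Ici (t : ℝ)).isPathConnected nonempty_Ici).image continuous_real_toNNReal
      exact h.image γ.continuous_toFun
    refine hpc.subset_pathComponentIn ⟨t, self_mem_Ici, rfl⟩ ?_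
    rintro _ ⟨s, hs, rfl⟩
    exact ht s hs
  exact ⟨t, γ.toFun t, ht t le_rfl, key, key⟩

theorem ProperRay.SameEnd.symm {x₀ : X} {γ₁ γ₂ : ProperRay X x₀} (h : γ₁.SameEnd γ₂) :
    γ₂.SameEnd γ₁ := by
  intro r hr
  obtain ⟨t, z, hz, h1, h2⟩ := h r hr
  exact ⟨t, z, hz, h2, h1⟩

theorem ProperRay.SameEnd.trans {x₀ : X} {γ₁ γ₂ γ₃ : ProperRay X x₀}
    (h : γ₁.SameEnd γ₂) (h' : γ₂.SameEnd γ₃) : γ₁.SameEnd γ₃ := by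
  intro r hr
  obtain ⟨t, z, hz, h1, h2⟩ := h r hr
  obtain ⟨t', z', -, h2', h3⟩ := h' r hr
  have heq := pathComponentIn_eq_of_mem_both
    (h2 (mem_image_of_mem _ (mem_Ici.2 (le_max_left t t'))))
    (h2' (mem_image_of_mem _ (mem_Ici.2 (le_max_right t t'))))
  refine ⟨max t t', z, hz, ?_, ?_⟩
  · exact (image_mono (Ici_subset_Ici.2 (le_max_left _ _))).trans h1
  · rw [heq]
    exact (image_mono (Ici_subset_Ici.2 (le_max_right _ _))).trans h3

/-- Converging to the same end is an equivalence relation on proper rays. -/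
instance ProperRay.setoid (X : Type u) [MetricSpace X] (x₀ : X) : Setoid (ProperRay X x₀) where
  r := ProperRay.SameEnd
  iseqv := ⟨ProperRay.SameEnd.refl, ProperRay.SameEnd.symm, ProperRay.SameEnd.trans⟩

/-- The space of ends: equivalence classes of proper rays. -/
def SpaceOfEnds (X : Type u) [MetricSpace X] (x₀ : X) : Type u :=
  Quotient (ProperRay.setoid X x₀)

/-- The end of a proper ray. -/
def ProperRay.toEnd {x₀ : X} (γ : ProperRay X x₀) : SpaceOfEnds X x₀ :=
  Quotient.mk (ProperRay.setoid X x₀) γ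

/-- Convergence of a sequence of ends: `e n = end (γ n)`, `e' = end γ'`, and for every `r` there are
`N n` such that, for all large `n`, the tails of `γ n` and `γ'` from time `N n` on lie in the same
path component of the complement of the closed ball of radius `r`. (Whether this holds does not
depend on the representatives.) -/
def SpaceOfEnds.ConvergesTo {x₀ : X} (e : ℕ → SpaceOfEnds X x₀) (e' : SpaceOfEnds X x₀) : Prop :=
  ∃ (γ : ℕ → ProperRay X x₀) (γ' : ProperRay X x₀),
    (∀ n, (γ n).toEnd = e n) ∧ γ'.toEnd = e' ∧
    ∀ r : ℝ, 0 ≤ r → ∃ N : ℕ → ℝ≥0, ∀ᶠ n in atTop,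
      InSamePathComponent x₀ r ((γ n).toFun '' Ici (N n)) (γ'.toFun '' Ici (N n))

theorem SpaceOfEnds.ConvergesTo.subseq {x₀ : X} {e : ℕ → SpaceOfEnds X x₀}
    {e' : SpaceOfEnds X x₀} (h : SpaceOfEnds.ConvergesTo e e') {φ : ℕ → ℕ} (hφ : StrictMono φ) :
    SpaceOfEnds.ConvergesTo (e ∘ φ) e' := by
  obtain ⟨γ, γ', h1, h2, h3⟩ := h
  refine ⟨γ ∘ φ, γ', fun n => h1 (φ n), h2, fun r hr => ?_⟩
  obtain ⟨N, hN⟩ := h3 r hr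
  exact ⟨N ∘ φ, hφ.tendsto_atTop.eventually hN⟩

/-- The topology induced by convergence of sequences of ends: a set of ends is closed if and only if
it contains the limits of all convergent sequences of its elements. -/
instance SpaceOfEnds.topologicalSpace (X : Type u) [MetricSpace X] (x₀ : X) :
    TopologicalSpace (SpaceOfEnds X x₀) where
  IsOpen U := ∀ (e : ℕ → SpaceOfEnds X x₀) (e' : SpaceOfEnds X x₀),
    (∀ n, e n ∈ Uᶜ) → SpaceOfEnds.ConvergesTo e e' → e' ∈ Uᶜ
  isOpen_univ e _ h _ := absurd (mem_univ (e 0)) (h 0)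
  isOpen_inter U V hU hV e e' h hc := by
    have h' : ∀ n, e n ∈ Uᶜ ∨ e n ∈ Vᶜ := fun n => by
      have := h n
      rwa [compl_inter] at this
    rw [compl_inter]
    by_cases hf : ∃ᶠ n in atTop, e n ∈ Uᶜ
    · obtain ⟨φ, hφ, hφU⟩ := extraction_of_frequently_atTop hf
      exact Or.inl (hU (e ∘ φ) e' hφU (hc.subseq hφ))
    · obtain ⟨φ, hφ, hφV⟩ := extraction_of_frequently_atTop
        ((not_frequently.1 hf).mono fun n hn => (h' n).resolve_left hn).frequently
      exact Or.inr (hV (e ∘ φ) e' hφV (hc.subseq hφ))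
  isOpen_sUnion S hS e e' h hc := by
    rintro ⟨U, hU, he'⟩
    exact hS U hU e e' (fun n hn => h n ⟨U, hU, hn⟩) hc he'

theorem SpaceOfEnds.isClosed_iff {x₀ : X} (C : Set (SpaceOfEnds X x₀)) :
    IsClosed C ↔ ∀ (e : ℕ → SpaceOfEnds X x₀) (e' : SpaceOfEnds X x₀),
      (∀ n, e n ∈ C) → SpaceOfEnds.ConvergesTo e e' → e' ∈ C := by
  rw [← isOpen_compl_iff]
  change (∀ (e : ℕ → SpaceOfEnds X x₀) (e' : SpaceOfEnds X x₀),
    (∀ n, e n ∈ Cᶜᶜ) → SpaceOfEnds.ConvergesTo e e' → e' ∈ Cᶜᶜ) ↔ _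
  rw [compl_compl]

end Ends

/-! ### The geometric realisation of a connected graph, with the path metric -/

section Realisation

variable {V : Type v}

open Classical in
/-- The vertex `a` as a point with barycentric coordinates. -/
noncomputable def vertexCoord (a : V) : V → ℝ := Pi.single a 1

/-- The geometric realisation of a connected 1-dimensional simplicial complex (a simple graph), in
barycentric coordinates: its points are the vertices and the points of the closed edges. -/
@[ext]
structure MetricGraph (G : SimpleGraph V) (hG : G.Connected) where
  coord : V → ℝ
  mem_simplex : (∃ a, coord = vertexCoord a) ∨
    ∃ a b, G.Adj a b ∧ coord ∈ segment ℝ (vertexCoord a) (vertexCoord b)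

namespace MetricGraph

variable {G : SimpleGraph V} {hG : G.Connected}

/-- The vertex `a` of the realisation. -/
noncomputable def vertex (hG : G.Connected) (a : V) : MetricGraph G hG :=
  ⟨vertexCoord a, Or.inl ⟨a, rfl⟩⟩

/-- The point `p` lies on the closed edge with endpoints `a` and `b`. -/
def OnEdge (p : MetricGraph G hG) (a b : V) : Prop :=
  G.Adj a b ∧ p.coord ∈ segment ℝ (vertexCoord a) (vertexCoord b)

/-- `HasPath p q L`: there is a piecewise linear path of length `L` from `p` to `q`. Each of its
pieces lies in one closed edge, where lengths are measured by a barycentric coordinate, so that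
every edge is isometric to `[0, 1]`. -/
inductive HasPath : MetricGraph G hG → MetricGraph G hG → ℝ → Prop
  | nil (p : MetricGraph G hG) : HasPath p p 0
  | cons {p q r : MetricGraph G hG} {L : ℝ} (a b : V) (hp : p.OnEdge a b) (hq : q.OnEdge a b)
      (h : HasPath q r L) : HasPath p r (|p.coord a - q.coord a| + L)

theorem HasPath.nonneg {p q : MetricGraph G hG} {L : ℝ} (h : HasPath p q L) : 0 ≤ L := by
  induction h with
  | nil p => exact le_rfl
  | cons a b hp hq h ih => positivity

theorem HasPath.trans {p q r : MetricGraph G hG} {L M : ℝ} (h : HasPath p q L)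
    (h' : HasPath q r M) : HasPath p r (L + M) := by
  induction h with
  | nil p => rwa [zero_add]
  | cons a b hp hq h ih =>
    rw [add_assoc]
    exact HasPath.cons a b hp hq (ih h')

theorem HasPath.symm {p q : MetricGraph G hG} {L : ℝ} (h : HasPath p q L) : HasPath q p L := by
  induction h with
  | nil p => exact HasPath.nil p
  | cons a b hp hq h ih =>
    have h1 := ih.trans (HasPath.cons a b hq hp (HasPath.nil _))
    rwa [abs_sub_comm, add_zero, add_comm] at h1

theorem onEdge_vertex_left {a b : V} (h : G.Adj a b) : (vertex hG a).OnEdge a b :=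
  ⟨h, left_mem_segment _ _ _⟩

theorem onEdge_vertex_right {a b : V} (h : G.Adj a b) : (vertex hG b).OnEdge a b :=
  ⟨h, right_mem_segment _ _ _⟩

theorem exists_hasPath_vertex (p : MetricGraph G hG) : ∃ a L, HasPath p (vertex hG a) L := by
  rcases p.mem_simplex with ⟨a, ha⟩ | ⟨a, b, hab, hp⟩
  · refine ⟨a, 0, ?_⟩
    have : p = vertex hG a := MetricGraph.ext ha
    rw [this]
    exact HasPath.nil _
  · exact ⟨a, _, HasPath.cons a b ⟨hab, hp⟩ (onEdge_vertex_left hab) (HasPath.nil _)⟩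

theorem exists_hasPath (p q : MetricGraph G hG) : ∃ L, HasPath p q L := by
  obtain ⟨a, L, hL⟩ := exists_hasPath_vertex p
  obtain ⟨b, M, hM⟩ := exists_hasPath_vertex q
  obtain ⟨w⟩ := hG.preconnected a b
  have hw : ∃ K, HasPath (vertex hG a) (vertex hG b) K := by
    clear hL hM
    induction w with
    | nil => exact ⟨0, HasPath.nil _⟩
    | cons h w ih =>
      obtain ⟨K, hK⟩ := ih
      exact ⟨_, HasPath.cons _ _ (onEdge_vertex_left h) (onEdge_vertex_right h) hK⟩
  obtain ⟨K, hK⟩ := hw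
  exact ⟨_, (hL.trans hK).trans hM.symm⟩

theorem abs_coord_sub_le_of_onEdge {p q : MetricGraph G hG} {a b : V} (hp : p.OnEdge a b)
    (hq : q.OnEdge a b) (c : V) : |p.coord c - q.coord c| ≤ |p.coord a - q.coord a| := by
  classical
  obtain ⟨hab, s, s', hs, hs', hss, hps⟩ := hp
  obtain ⟨-, t, t', ht, ht', htt, hqt⟩ := hq
  have hne : a ≠ b := hab.ne
  have hpc : ∀ c, p.coord c = s * vertexCoord a c + s' * vertexCoord b c := fun c => by
    rw [← hps]; rfl
  have hqc : ∀ c, q.coord c = t * vertexCoord a c + t' * vertexCoord b c := fun c => by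
    rw [← hqt]; rfl
  have hv : ∀ a c : V, vertexCoord a c = if c = a then 1 else 0 := fun a c => by
    simp [vertexCoord, Pi.single_apply]
  rw [hpc, hqc, hpc, hqc]
  simp only [hv, if_neg hne, if_true, mul_one, mul_zero, add_zero]
  by_cases hca : c = a
  · subst hca
    simp [hne]
  · by_cases hcb : c = b
    · subst hcb
      have h1 : s' - t' = -(s - t) := by linarith
      simp [hca, h1, abs_sub_comm]
    · simp [hca, hcb]

theorem HasPath.abs_coord_sub_le {p q : MetricGraph G hG} {L : ℝ} (h : HasPath p q L) (c : V) :
    |p.coord c - q.coord c| ≤ L := by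
  induction h with
  | nil p => simp
  | cons a b hp hq h ih =>
    exact (abs_sub_le _ _ _).trans (add_le_add (abs_coord_sub_le_of_onEdge hp hq c) ih)

/-- The path metric: the distance of two points is the infimum of the lengths of the paths between
them. -/
noncomputable def pathDist (p q : MetricGraph G hG) : ℝ := sInf {L | HasPath p q L}

theorem pathDist_le {p q : MetricGraph G hG} {L : ℝ} (h : HasPath p q L) : pathDist p q ≤ L :=
  csInf_le ⟨0, fun _ hM => hM.nonneg⟩ h

theorem le_pathDist {p q : MetricGraph G hG} {K : ℝ} (h : ∀ L, HasPath p q L → K ≤ L) :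
    K ≤ pathDist p q :=
  le_csInf (exists_hasPath p q) h

theorem pathDist_comm_le (p q : MetricGraph G hG) : pathDist p q ≤ pathDist q p :=
  le_pathDist fun _ h => pathDist_le h.symm

noncomputable instance : MetricSpace (MetricGraph G hG) where
  dist := pathDist
  dist_self p := le_antisymm (pathDist_le (HasPath.nil p)) (le_pathDist fun _ h => h.nonneg)
  dist_comm p q := le_antisymm (pathDist_comm_le p q) (pathDist_comm_le q p)
  dist_triangle p q r := by
    rw [← sub_le_iff_le_add]
    refine le_pathDist fun L hL => ?_
    rw [sub_le_iff_le_add, ← sub_le_iff_le_add']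
    refine le_pathDist fun M hM => ?_
    rw [sub_le_iff_le_add']
    exact pathDist_le (hL.trans hM)
  eq_of_dist_eq_zero {p q} h := by
    change pathDist p q = 0 at h
    refine MetricGraph.ext (funext fun c => ?_)
    have h1 : |p.coord c - q.coord c| ≤ pathDist p q :=
      le_pathDist fun _ hL => hL.abs_coord_sub_le c
    rw [h] at h1
    exact sub_eq_zero.1 (abs_eq_zero.1 (le_antisymm h1 (abs_nonneg _)))

theorem dist_eq_pathDist (p q : MetricGraph G hG) : dist p q = pathDist p q := rfl

end MetricGraph

end Realisation

/-!
Fix a base point `o` of `X`. The path components of the complement of the closed ball of radius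
`n - 1` around `o` that contain points at distance at least `n` from `o` are the vertices of level
`n` of a rooted tree `T`, in which the parent of a component is the component for `n - 1` that
contains it. Each level is finite: on the way to `o` every path meets the sphere of radius `n`,
which is compact, and nearby points of that sphere lie in the same component.

A proper ray eventually stays in one component for each `n`, and so determines a branch of `T`; two
rays converge to the same end if and only if their branches agree, every branch arises by joining
points chosen in its components, and convergence of ends is pointwise convergence of branches. All
this uses only the labelling of the components by the vertices of `T`. The components of the
realisation of `T` are labelled by `T` as well, so both spaces have the same ends.

Writing `(p|q)` for the height at which the geodesics from the root to `p` and to `q` separate, the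
path metric of the realisation is `height p + height q - 2 (p|q)`. Since
`(p|r) ≥ min (p|q) (q|r)`, the realisation is zero-hyperbolic, and in a zero-hyperbolic space the
points between `x` and `y` separate `x` from `y`, which makes geodesics unique as embedded arcs.
-/

/-! ### Geodesics and zero-hyperbolic spaces -/

theorem lipschitzOnWith_of_inter_Iic_of_inter_Ici {Y : Type*} [PseudoMetricSpace Y] {f : ℝ → Y}
    {K : ℝ≥0} {s : Set ℝ} {b : ℝ} (hb : b ∈ s) (h₁ : LipschitzOnWith K f (s ∩ Iic b))
    (h₂ : LipschitzOnWith K f (s ∩ Ici b)) : LipschitzOnWith K f s := by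
  have across : ∀ u ∈ s, ∀ v ∈ s, u ≤ b → b ≤ v → dist (f u) (f v) ≤ K * dist u v := by
    intro u hu v hv hub hbv
    calc dist (f u) (f v) ≤ dist (f u) (f b) + dist (f b) (f v) := dist_triangle _ _ _
      _ ≤ K * dist u b + K * dist b v :=
        add_le_add (h₁.dist_le_mul _ ⟨hu, hub⟩ _ ⟨hb, self_mem_Iic⟩)
          (h₂.dist_le_mul _ ⟨hb, self_mem_Ici⟩ _ ⟨hv, hbv⟩)
      _ = K * dist u v := by
        rw [← mul_add, Real.dist_eq, Real.dist_eq, Real.dist_eq, abs_of_nonpos (by linarith),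
          abs_of_nonpos (by linarith), abs_of_nonpos (by linarith)]
        ring
  refine LipschitzOnWith.of_dist_le_mul fun u hu v hv => ?_
  rcases le_total u b with hub | hbu <;> rcases le_total v b with hvb | hbv
  · exact h₁.dist_le_mul _ ⟨hu, hub⟩ _ ⟨hv, hvb⟩
  · exact across u hu v hv hub hbv
  · rw [dist_comm (f u), dist_comm u]
    exact across v hv u hu hvb hbu
  · exact h₂.dist_le_mul _ ⟨hu, hbu⟩ _ ⟨hv, hbv⟩

theorem eq_image_Icc_of_isPreconnected {Y : Type*} [TopologicalSpace Y] {β : ℝ → Y} {a b : ℝ}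
    (hab : a ≤ b) (hβ : IsEmbedding ((Icc a b).domRestrict β)) {A : Set Y} (hA : IsPreconnected A)
    (hAβ : A ⊆ β '' Icc a b) (ha : β a ∈ A) (hb : β b ∈ A) : A = β '' Icc a b := by
  refine hAβ.antisymm ?_
  have hpre : IsPreconnected ((Icc a b).domRestrict β ⁻¹' A) := by
    rw [← hβ.isInducing.isPreconnected_image, image_preimage_eq_of_subset]
    · exact hA
    · rwa [range_domRestrict]
  have hIcc := (hpre.image _ continuous_subtype_val.continuousOn).Icc_subset
    ⟨⟨a, left_mem_Icc.2 hab⟩, ha, rfl⟩ ⟨⟨b, right_mem_Icc.2 hab⟩, hb, rfl⟩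
  rintro _ ⟨s, hs, rfl⟩
  obtain ⟨s, hsA, rfl⟩ := hIcc hs
  exact hsA

section Geodesics

variable {X : Type u} [MetricSpace X] {α β : ℝ → X} {x y z : X}

namespace IsGeodesicFromTo

theorem of_lipschitzOnWith (h₀ : α 0 = x) (h₁ : α (dist x y) = y)
    (h : LipschitzOnWith 1 α (Icc 0 (dist x y))) : IsGeodesicFromTo α x y := by
  have hle : ∀ s ∈ Icc 0 (dist x y), ∀ t ∈ Icc 0 (dist x y), dist (α s) (α t) ≤ |s - t| :=
    fun s hs t ht => by simpa [Real.dist_eq] using h.dist_le_mul s hs t ht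
  have hlt : ∀ s ∈ Icc 0 (dist x y), ∀ t ∈ Icc 0 (dist x y), s ≤ t →
      dist (α s) (α t) = |s - t| := by
    intro s hs t ht hst
    refine (hle s hs t ht).antisymm ?_
    have hxs : dist x (α s) ≤ s := by
      simpa [h₀, abs_of_nonneg hs.1] using hle 0 (left_mem_Icc.2 dist_nonneg) s hs
    have hty : dist (α t) y ≤ dist x y - t := by
      simpa [h₁, abs_of_nonpos (sub_nonpos.2 ht.2)] using
        hle t ht _ (right_mem_Icc.2 dist_nonneg)
    rw [abs_of_nonpos (by linarith)]
    linarith [dist_triangle4 x (α s) (α t) y]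
  refine ⟨h₀, h₁, fun s hs t ht => ?_⟩
  rcases le_total s t with hst | hts
  · exact hlt s hs t ht hst
  · rw [dist_comm, abs_sub_comm]
    exact hlt t ht s hs hts

theorem lipschitzOnWith (h : IsGeodesicFromTo α x y) : LipschitzOnWith 1 α (Icc 0 (dist x y)) :=
  LipschitzOnWith.of_dist_le_mul fun s hs t ht => by
    rw [NNReal.coe_one, one_mul, h.2.2 s hs t ht, Real.dist_eq]

theorem dist_left (h : IsGeodesicFromTo α x y) {s : ℝ} (hs : s ∈ Icc 0 (dist x y)) :
    dist x (α s) = s := by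
  conv_lhs => rw [← h.1, h.2.2 0 (left_mem_Icc.2 dist_nonneg) s hs]
  rw [zero_sub, abs_neg, abs_of_nonneg hs.1]

theorem dist_right (h : IsGeodesicFromTo α x y) {s : ℝ} (hs : s ∈ Icc 0 (dist x y)) :
    dist (α s) y = dist x y - s := by
  conv_lhs => rw [← h.2.1, h.2.2 s hs _ (right_mem_Icc.2 dist_nonneg)]
  rw [abs_of_nonpos (sub_nonpos.2 hs.2), neg_sub]

theorem left_mem_image (h : IsGeodesicFromTo α x y) : x ∈ α '' Icc 0 (dist x y) :=
  ⟨0, left_mem_Icc.2 dist_nonneg, h.1⟩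

theorem right_mem_image (h : IsGeodesicFromTo α x y) : y ∈ α '' Icc 0 (dist x y) :=
  ⟨_, right_mem_Icc.2 dist_nonneg, h.2.1⟩

theorem isPathConnected_image (h : IsGeodesicFromTo α x y) :
    IsPathConnected (α '' Icc 0 (dist x y)) :=
  ((convex_Icc _ _).isPathConnected ⟨0, left_mem_Icc.2 dist_nonneg⟩).image'
    h.lipschitzOnWith.continuousOn

theorem symm (h : IsGeodesicFromTo α x y) : IsGeodesicFromTo (fun s => α (dist x y - s)) y x := by
  have hd := dist_comm y x
  refine of_lipschitzOnWith (by rw [sub_zero, h.2.1]) (by rw [hd, sub_self, h.1])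
    (.of_dist_le_mul fun s hs t ht => ?_)
  rw [hd] at hs ht
  rw [← dist_sub_left (dist x y) s t]
  exact h.lipschitzOnWith.dist_le_mul _ ⟨by linarith [hs.2], by linarith [hs.1]⟩ _
    ⟨by linarith [ht.2], by linarith [ht.1]⟩

theorem trans (hα : IsGeodesicFromTo α x z) (hβ : IsGeodesicFromTo β z y)
    (h : dist x z + dist z y = dist x y) :
    IsGeodesicFromTo (fun s => if s ≤ dist x z then α s else β (s - dist x z)) x y := by
  have hle : dist x z ≤ dist x y := by linarith [dist_nonneg (x := z) (y := y)]
  have hβ' : ∀ s, dist x z ≤ s →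
      (if s ≤ dist x z then α s else β (s - dist x z)) = β (s - dist x z) := by
    intro s hs
    split_ifs with hs'
    · rw [le_antisymm hs' hs, sub_self, hα.2.1, hβ.1]
    · rfl
  refine of_lipschitzOnWith (by simp only [dist_nonneg, if_true, hα.1]) ?_
    (lipschitzOnWith_of_inter_Iic_of_inter_Ici (b := dist x z) ⟨dist_nonneg, hle⟩
      (.of_dist_le_mul fun s hs t ht => ?_) (.of_dist_le_mul fun s hs t ht => ?_))
  · rw [hβ' _ hle, ← h, add_sub_cancel_left, hβ.2.1]
  · rw [if_pos (mem_Iic.1 hs.2), if_pos (mem_Iic.1 ht.2)]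
    exact hα.lipschitzOnWith.dist_le_mul s ⟨hs.1.1, hs.2⟩ t ⟨ht.1.1, ht.2⟩
  · rw [hβ' s hs.2, hβ' t ht.2, ← dist_sub_right s t (dist x z)]
    exact hβ.lipschitzOnWith.dist_le_mul _ ⟨sub_nonneg.2 hs.2, by linarith [hs.1.2]⟩ _
      ⟨sub_nonneg.2 ht.2, by linarith [ht.1.2]⟩

end IsGeodesicFromTo

/-- A metric space is zero-hyperbolic if it satisfies Gromov's four-point condition with constant
zero: of the three sums of opposite distances of any four points, the two largest are equal. -/
def IsZeroHyperbolic (X : Type u) [MetricSpace X] : Prop :=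
  ∀ x y z w : X, dist x y + dist z w ≤ max (dist x z + dist y w) (dist x w + dist y z)

theorem IsZeroHyperbolic.isOpen_setOf_between (hX : IsZeroHyperbolic X) (x z : X) :
    IsOpen {w | w ≠ z ∧ dist x z + dist z w ≤ dist x w} := by
  rw [Metric.isOpen_iff]
  rintro w ⟨hwz, hw⟩
  refine ⟨dist z w, dist_pos.2 hwz.symm, fun w' hw' => ?_⟩
  rw [mem_ball, dist_comm] at hw'
  refine ⟨fun h => hw'.ne (by rw [h, dist_comm]), ?_⟩
  rcases le_max_iff.1 (hX x w z w') with h | h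
  · linarith [dist_nonneg (x := z) (y := w')]
  · linarith [dist_comm w z]

/-- A point `z` strictly between `x` and `y` separates them: the points `w` for which `z` lies
between `x` and `w`, and those for which it does not, form two open sets that cover `{z}ᶜ`. -/
theorem IsZeroHyperbolic.mem_of_isPreconnected (hX : IsZeroHyperbolic X) {S : Set X}
    (hS : IsPreconnected S) (hx : x ∈ S) (hy : y ∈ S) (hz : dist x z + dist z y = dist x y) :
    z ∈ S := by
  by_contra hzS
  have hne : ∀ w ∈ S, w ≠ z := fun w hw h => hzS (h ▸ hw)
  have hopen : IsOpen {w | dist x w < dist x z + dist z w} :=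
    isOpen_lt (by fun_prop) (by fun_prop)
  obtain ⟨w, -, hw, -, hw'⟩ := hS _ _ hopen (hX.isOpen_setOf_between x z)
    (fun w hw => (lt_or_ge (dist x w) _).imp id fun h => ⟨hne w hw, h⟩)
    ⟨x, hx, by simpa [dist_comm z x] using hne x hx⟩
    ⟨y, hy, hne y hy, hz.le⟩
  exact hw'.not_gt hw

theorem IsZeroHyperbolic.isRTree (hX : IsZeroHyperbolic X) (hgeod : IsGeodesicSpace X) :
    IsRTree X := by
  intro x y
  obtain ⟨α, hα⟩ := hgeod x y
  refine ⟨α, hα, fun r β hr hβ₀ hβr hβ => Eq.symm ?_⟩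
  have hβconn : IsPreconnected (β '' Icc 0 r) :=
    isPreconnected_Icc.image β (continuousOn_iff_continuous_domRestrict.2 hβ.continuous)
  refine eq_image_Icc_of_isPreconnected hr hβ
    hα.isPathConnected_image.isConnected.isPreconnected ?_
    (hβ₀ ▸ hα.left_mem_image) (hβr ▸ hα.right_mem_image)
  rintro _ ⟨s, hs, rfl⟩
  refine hX.mem_of_isPreconnected hβconn ⟨0, left_mem_Icc.2 hr, hβ₀⟩ ⟨r, right_mem_Icc.2 hr, hβr⟩ ?_
  rw [hα.dist_left hs, hα.dist_right hs, add_sub_cancel]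

end Geodesics

/-! ### Rooted trees and their realisations -/

namespace MetricGraph

variable {V : Type v} {G : SimpleGraph V} {hG : G.Connected} {p q : MetricGraph G hG} {a b : V}

theorem vertexCoord_self (a : V) : vertexCoord a a = 1 := by
  simp [vertexCoord]

theorem vertexCoord_of_ne (h : b ≠ a) : vertexCoord a b = 0 := by
  simp [vertexCoord, h]

theorem vertex_injective : Function.Injective (vertex hG) := by
  intro a b h
  by_contra hab
  have hcoord : vertexCoord a a = vertexCoord b a := congrFun (congrArg coord h) a
  rw [vertexCoord_self, vertexCoord_of_ne hab] at hcoord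
  exact one_ne_zero hcoord

theorem OnEdge.symm (h : p.OnEdge a b) : p.OnEdge b a :=
  ⟨h.1.symm, segment_symm ℝ (vertexCoord a) (vertexCoord b) ▸ h.2⟩

theorem abs_coord_sub_eq_of_onEdge (hp : p.OnEdge a b) (hq : q.OnEdge a b) :
    |p.coord a - q.coord a| = |p.coord b - q.coord b| :=
  (abs_coord_sub_le_of_onEdge hp.symm hq.symm a).antisymm (abs_coord_sub_le_of_onEdge hp hq b)

theorem dist_le_of_onEdge (hp : p.OnEdge a b) (hq : q.OnEdge a b) :
    dist p q ≤ |p.coord a - q.coord a| := by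
  rw [dist_eq_pathDist, ← add_zero |p.coord a - q.coord a|]
  exact pathDist_le (.cons a b hp hq (.nil q))

end MetricGraph

/-- A rooted tree, encoded by its level function and the map that sends every vertex to its parent.
The root is its own parent. -/
structure LeveledTree (V : Type v) where
  root : V
  parent : V → V
  level : V → ℕ
  level_root : level root = 0
  level_parent : ∀ v, level (parent v) = level v - 1
  eq_root : ∀ v, level v = 0 → v = root

namespace LeveledTree

open MetricGraph

variable {V : Type v} (T : LeveledTree V) {u v w : V} {k n : ℕ}

theorem parent_root : T.parent T.root = T.root :=
  T.eq_root _ (by rw [T.level_parent, T.level_root])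

theorem ne_parent (h : T.level v ≠ 0) : v ≠ T.parent v := fun hv => by
  have := T.level_parent v
  rw [← hv] at this
  omega

/-- The underlying graph of a rooted tree: every vertex other than the root is joined to its
parent. -/
def graph : SimpleGraph V :=
  SimpleGraph.fromRel fun a b => T.parent a = b

theorem adj_parent (h : T.level v ≠ 0) : T.graph.Adj v (T.parent v) :=
  ⟨T.ne_parent h, Or.inl rfl⟩

theorem level_ne_zero_of_adj_parent (h : T.graph.Adj v (T.parent v)) : T.level v ≠ 0 := by
  intro hv
  rw [T.eq_root v hv, T.parent_root] at h
  exact h.ne rfl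

theorem reachable_root (v : V) : T.graph.Reachable v T.root := by
  induction hn : T.level v generalizing v with
  | zero => rw [T.eq_root v hn]
  | succ n ih =>
    exact (T.adj_parent (by omega)).reachable.trans (ih _ (by rw [T.level_parent, hn]; rfl))

theorem graph_connected : T.graph.Connected where
  preconnected a b := (T.reachable_root a).trans (T.reachable_root b).symm
  nonempty := ⟨T.root⟩

theorem finite_neighborSet (h : ∀ n, {v | T.level v = n}.Finite) (a : V) :
    (T.graph.neighborSet a).Finite := by
  refine ((finite_Iic (T.level a + 1)).biUnion fun n _ => h n).subset fun b hb => ?_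
  simp only [mem_iUnion, mem_ofPred_eq, mem_Iic, exists_prop, exists_eq_right']
  have ha := T.level_parent a
  have hb' := T.level_parent b
  rcases hb.2 with rfl | rfl <;> omega

/-- The ancestor of `v` at level `n`, which is `v` itself if its level is at most `n`. -/
def ancestor (v : V) (n : ℕ) : V :=
  T.parent^[T.level v - n] v

theorem level_parent_iterate (v : V) (k : ℕ) : T.level (T.parent^[k] v) = T.level v - k := by
  induction k with
  | zero => rfl
  | succ k ih => rw [Function.iterate_succ_apply', T.level_parent, ih, Nat.sub_sub]

theorem level_ancestor (v : V) (n : ℕ) : T.level (T.ancestor v n) = min n (T.level v) := by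
  rw [ancestor, level_parent_iterate]
  omega

theorem level_ancestor_of_le (h : n ≤ T.level v) : T.level (T.ancestor v n) = n := by
  rw [level_ancestor, min_eq_left h]

theorem ancestor_of_level_le (h : T.level v ≤ n) : T.ancestor v n = v := by
  rw [ancestor, Nat.sub_eq_zero_of_le h, Function.iterate_zero_apply]

theorem ancestor_zero (v : V) : T.ancestor v 0 = T.root :=
  T.eq_root _ (T.level_ancestor_of_le (Nat.zero_le _))

theorem ancestor_ancestor (v : V) (h : k ≤ n) : T.ancestor (T.ancestor v n) k = T.ancestor v k := by
  rw [ancestor, level_ancestor, ancestor, ancestor, ← Function.iterate_add_apply]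
  congr 2
  omega

theorem parent_ancestor_succ (h : n < T.level v) :
    T.parent (T.ancestor v (n + 1)) = T.ancestor v n := by
  rw [ancestor, ancestor, ← Function.iterate_succ_apply' T.parent]
  congr 2
  omega

/-- The geometric realisation of a rooted tree. -/
abbrev Realisation : Type v :=
  MetricGraph T.graph T.graph_connected

/-- The barycentric coordinate at `u` of the point of height `s` on the edge from `u` to its parent,
where heights outside `[level u - 1, level u]` are clamped to that interval. -/
noncomputable def edgeParam (u : V) (s : ℝ) : Icc (0 : ℝ) 1 :=
  projIcc 0 1 zero_le_one (s - T.level u + 1)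

theorem edgeParam_of_mem {s : ℝ} (h₁ : T.level u ≤ s + 1) (h₂ : s ≤ T.level u) :
    (T.edgeParam u s : ℝ) = s - T.level u + 1 := by
  rw [edgeParam, projIcc_of_mem _ ⟨by linarith, by linarith⟩]

theorem edgeParam_of_level_le {s : ℝ} (h : T.level u ≤ s) : (T.edgeParam u s : ℝ) = 1 := by
  rw [edgeParam, projIcc_of_right_le _ (by linarith)]

theorem lineMap_mem_edge (u : V) (s : ℝ) :
    AffineMap.lineMap (vertexCoord (T.parent u)) (vertexCoord u) (T.edgeParam u s : ℝ) ∈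
      segment ℝ (vertexCoord u) (vertexCoord (T.parent u)) :=
  segment_symm ℝ (vertexCoord (T.parent u)) (vertexCoord u) ▸
    lineMap_mem_segment ℝ _ _ (T.edgeParam u s).2

/-- The point of height `s` on the closed edge between `u` and its parent, where heights outside
`[level u - 1, level u]` are clamped to that interval. For the root this is the root itself. -/
noncomputable def edgePoint (u : V) (s : ℝ) : T.Realisation where
  coord := AffineMap.lineMap (vertexCoord (T.parent u)) (vertexCoord u) (T.edgeParam u s : ℝ)
  mem_simplex := by
    by_cases h : T.level u = 0
    · refine Or.inl ⟨u, ?_⟩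
      rw [T.eq_root u h, T.parent_root, AffineMap.lineMap_same_apply]
    · exact Or.inr ⟨u, T.parent u, T.adj_parent h, T.lineMap_mem_edge u s⟩

theorem onEdge_edgePoint (h : T.level u ≠ 0) (s : ℝ) : (T.edgePoint u s).OnEdge u (T.parent u) :=
  ⟨T.adj_parent h, T.lineMap_mem_edge u s⟩

theorem coord_edgePoint (u : V) (s : ℝ) (w : V) : (T.edgePoint u s).coord w =
    AffineMap.lineMap (vertexCoord (T.parent u) w) (vertexCoord u w) (T.edgeParam u s : ℝ) :=
  AffineMap.pi_lineMap_apply _ _ _ _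

theorem coord_edgePoint_self (h : T.level u ≠ 0) (s : ℝ) :
    (T.edgePoint u s).coord u = T.edgeParam u s := by
  rw [coord_edgePoint, vertexCoord_self, vertexCoord_of_ne (T.ne_parent h),
    AffineMap.lineMap_apply_ring', sub_zero, mul_one, add_zero]

theorem edgePoint_root (s : ℝ) : T.edgePoint T.root s = vertex _ T.root := by
  ext1
  simp only [edgePoint, parent_root, AffineMap.lineMap_same_apply, vertex]

theorem edgePoint_of_level_le {s : ℝ} (h : T.level u ≤ s) : T.edgePoint u s = vertex _ u := by
  ext1
  simp only [edgePoint, T.edgeParam_of_level_le h, AffineMap.lineMap_apply_one, vertex]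

theorem edgePoint_of_le_level_sub_one {s : ℝ} (h : s + 1 ≤ T.level u) :
    T.edgePoint u s = vertex _ (T.parent u) := by
  ext1
  simp only [edgePoint, edgeParam, projIcc_of_le_left zero_le_one (x := s - T.level u + 1)
    (by linarith), AffineMap.lineMap_apply_zero, vertex]

theorem lipschitzWith_edgePoint (u : V) : LipschitzWith 1 (T.edgePoint u) := by
  by_cases h : T.level u = 0
  · rw [T.eq_root u h, funext T.edgePoint_root]
    exact (LipschitzWith.const _).weaken zero_le_one
  refine LipschitzWith.of_dist_le_mul fun s t => ?_
  have hproj := (LipschitzWith.projIcc (zero_le_one' ℝ)).dist_le_mul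
    (s - T.level u + 1) (t - T.level u + 1)
  rw [dist_add_right, dist_sub_right] at hproj
  refine (dist_le_of_onEdge (T.onEdge_edgePoint h s) (T.onEdge_edgePoint h t)).trans ?_
  rwa [T.coord_edgePoint_self h, T.coord_edgePoint_self h]

theorem eq_edgePoint_of_onEdge {p : T.Realisation} (hp : p.OnEdge u (T.parent u)) :
    p = T.edgePoint u (p.coord u + T.level u - 1) ∧ p.coord u ∈ Icc (0 : ℝ) 1 := by
  obtain ⟨hadj, hmem⟩ := hp
  rw [segment_symm, segment_eq_image_lineMap] at hmem
  obtain ⟨c, hc, hpc⟩ := hmem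
  have hcu : p.coord u = c := by
    rw [← hpc, AffineMap.pi_lineMap_apply, vertexCoord_self,
      vertexCoord_of_ne (T.ne_parent (T.level_ne_zero_of_adj_parent hadj)),
      AffineMap.lineMap_apply_ring', sub_zero, mul_one, add_zero]
  rw [hcu]
  refine ⟨MetricGraph.ext ?_, hc⟩
  simp only [edgePoint, ← hpc]
  rw [T.edgeParam_of_mem (by linarith [hc.1]) (by linarith [hc.2])]
  congr 1
  ring

theorem coord_edgePoint_of_ceil_eq {s : ℝ} (hs : 0 ≤ s) (h : ⌈s⌉₊ = T.level u)
    (h₀ : T.level u ≠ 0) : (T.edgePoint u s).coord u = s - T.level u + 1 := by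
  rw [T.coord_edgePoint_self h₀, T.edgeParam_of_mem]
  · exact h ▸ (Nat.ceil_lt_add_one hs).le
  · exact h ▸ Nat.le_ceil s

theorem coord_edgePoint_pos {s : ℝ} (h : ⌈s⌉₊ = T.level u) : 0 < (T.edgePoint u s).coord u := by
  by_cases h₀ : T.level u = 0
  · rw [T.eq_root u h₀, edgePoint_root]
    exact one_pos.trans_eq (vertexCoord_self T.root).symm
  · have hs : 0 < s := Nat.ceil_pos.1 (by omega)
    rw [T.coord_edgePoint_of_ceil_eq hs.le h h₀, ← h]
    linarith [Nat.ceil_lt_add_one hs.le]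

theorem eq_or_eq_parent_of_coord_edgePoint_pos {s : ℝ} (h : 0 < (T.edgePoint u s).coord w) :
    w = u ∨ w = T.parent u := by
  by_contra! hw
  rw [coord_edgePoint, vertexCoord_of_ne hw.1, vertexCoord_of_ne hw.2,
    AffineMap.lineMap_same_apply] at h
  exact h.false

theorem eq_of_edgePoint_eq {s t : ℝ} (hu : ⌈s⌉₊ = T.level u) (hw : ⌈t⌉₊ = T.level w)
    (h : T.edgePoint u s = T.edgePoint w t) : u = w := by
  have huw := T.eq_or_eq_parent_of_coord_edgePoint_pos (h ▸ T.coord_edgePoint_pos hu)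
  have hwu := T.eq_or_eq_parent_of_coord_edgePoint_pos (h ▸ T.coord_edgePoint_pos hw)
  rcases huw with huw | huw
  · exact huw
  rcases hwu with hwu | hwu
  · exact hwu.symm
  have h₁ := T.level_parent w
  have h₂ := T.level_parent u
  rw [← huw] at h₁
  rw [← hwu] at h₂
  rw [T.eq_root u (by omega), T.eq_root w (by omega)]

theorem edgePoint_injOn (u : V) : InjOn (T.edgePoint u) {s | 0 ≤ s ∧ ⌈s⌉₊ = T.level u} := by
  rintro s ⟨hs, hsu⟩ t ⟨ht, htu⟩ h
  by_cases h₀ : T.level u = 0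
  · rw [h₀, Nat.ceil_eq_zero] at hsu htu
    exact (hsu.antisymm hs).trans (htu.antisymm ht).symm
  · have hcoord := congrFun (congrArg coord h) u
    rw [T.coord_edgePoint_of_ceil_eq hs hsu h₀, T.coord_edgePoint_of_ceil_eq ht htu h₀] at hcoord
    linarith

/-- The point of height `s` on the geodesic from the root to the vertex `v`, where heights outside
`[0, level v]` are clamped to that interval. -/
noncomputable def rootPath (v : V) (s : ℝ) : T.Realisation :=
  T.edgePoint (T.ancestor v ⌈s⌉₊) s

theorem rootPath_eq_edgePoint (v : V) {s : ℝ} (h₁ : n ≤ s + 1) (h₂ : s ≤ n) :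
    T.rootPath v s = T.edgePoint (T.ancestor v n) s := by
  rcases (Nat.ceil_le.2 h₂).eq_or_lt with h | h
  · rw [rootPath, h]
  have hn : n = ⌈s⌉₊ + 1 := by
    refine le_antisymm ?_ h
    have : (n : ℝ) ≤ (⌈s⌉₊ + 1 : ℕ) := by push_cast; linarith [Nat.le_ceil s]
    exact_mod_cast this
  subst hn
  push_cast at h₁
  rcases lt_or_ge ⌈s⌉₊ (T.level v) with hv | hv
  · rw [rootPath, edgePoint_of_level_le, edgePoint_of_le_level_sub_one, T.parent_ancestor_succ hv]
    · rw [T.level_ancestor_of_le hv]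
      push_cast
      linarith [Nat.le_ceil s]
    · rw [T.level_ancestor_of_le hv.le]
      linarith
  · rw [rootPath, T.ancestor_of_level_le hv, T.ancestor_of_level_le (by omega)]

theorem rootPath_natCast (v : V) (n : ℕ) : T.rootPath v n = vertex _ (T.ancestor v n) := by
  rw [rootPath, Nat.ceil_natCast, edgePoint_of_level_le]
  exact_mod_cast (T.level_ancestor v n).trans_le (min_le_left _ _)

theorem rootPath_of_nonpos (v : V) {s : ℝ} (h : s ≤ 0) : T.rootPath v s = vertex _ T.root := by
  rw [rootPath, Nat.ceil_eq_zero.2 h, ancestor_zero, edgePoint_root]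

theorem lipschitzWith_rootPath (v : V) : LipschitzWith 1 (T.rootPath v) := by
  have hIic : ∀ n : ℕ, LipschitzOnWith 1 (T.rootPath v) (Iic n) := by
    intro n
    induction n with
    | zero =>
      refine LipschitzOnWith.of_dist_le_mul fun s hs t ht => ?_
      rw [Nat.cast_zero] at hs ht
      rw [T.rootPath_of_nonpos v hs, T.rootPath_of_nonpos v ht, dist_self]
      positivity
    | succ n ih =>
      refine lipschitzOnWith_of_inter_Iic_of_inter_Ici (b := n) (by simp)
        (ih.mono inter_subset_right) (.of_dist_le_mul fun s hs t ht => ?_)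
      have key : ∀ r ∈ Iic ((n + 1 : ℕ) : ℝ) ∩ Ici (n : ℝ),
          T.rootPath v r = T.edgePoint (T.ancestor v (n + 1)) r := fun r hr =>
        T.rootPath_eq_edgePoint v (by push_cast; linarith [mem_Ici.1 hr.2]) hr.1
      rw [key s hs, key t ht]
      exact (T.lipschitzWith_edgePoint _).dist_le_mul s t
  refine LipschitzWith.of_dist_le_mul fun s t => ?_
  obtain ⟨n, hn⟩ := exists_nat_ge (max s t)
  exact (hIic n).dist_le_mul s ((le_max_left _ _).trans hn) t ((le_max_right _ _).trans hn)

theorem exists_rootPath_of_onEdge {p q : T.Realisation} {a b : V} (hp : p.OnEdge a b)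
    (hq : q.OnEdge a b) :
    ∃ u, ∃ s ∈ Icc (0 : ℝ) (T.level u), ∃ t ∈ Icc (0 : ℝ) (T.level u),
      T.rootPath u s = p ∧ T.rootPath u t = q ∧ |p.coord a - q.coord a| = |s - t| := by
  wlog hab : T.parent a = b generalizing a b
  · obtain ⟨u, s, hs, t, ht, hsp, htq, hst⟩ := this hp.symm hq.symm (hp.1.2.resolve_left hab)
    exact ⟨u, s, hs, t, ht, hsp, htq, (abs_coord_sub_eq_of_onEdge hp hq).trans hst⟩
  subst hab
  have hlevel : (1 : ℝ) ≤ T.level a := by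
    exact_mod_cast Nat.one_le_iff_ne_zero.2 (T.level_ne_zero_of_adj_parent hp.1)
  have key : ∀ {r : T.Realisation}, r.OnEdge a (T.parent a) →
      r.coord a + T.level a - 1 ∈ Icc (0 : ℝ) (T.level a) ∧
        T.rootPath a (r.coord a + T.level a - 1) = r := by
    intro r hr
    obtain ⟨hr', h₀, h₁⟩ := T.eq_edgePoint_of_onEdge hr
    refine ⟨⟨by linarith, by linarith⟩, ?_⟩
    rw [T.rootPath_eq_edgePoint a (n := T.level a) (by linarith) (by linarith),
      T.ancestor_of_level_le le_rfl, ← hr']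
  refine ⟨a, _, (key hp).1, _, (key hq).1, (key hp).2, (key hq).2, ?_⟩
  congr 1
  ring

theorem exists_rootPath_eq (p : T.Realisation) :
    ∃ v, ∃ s ∈ Icc (0 : ℝ) (T.level v), T.rootPath v s = p := by
  rcases p.mem_simplex with ⟨a, ha⟩ | ⟨a, b, hab, hp⟩
  · refine ⟨a, T.level a, ⟨Nat.cast_nonneg _, le_rfl⟩, ?_⟩
    rw [rootPath_natCast, T.ancestor_of_level_le le_rfl]
    exact (MetricGraph.ext ha).symm
  · obtain ⟨u, s, hs, -, -, h, -⟩ := T.exists_rootPath_of_onEdge ⟨hab, hp⟩ ⟨hab, hp⟩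
    exact ⟨u, s, hs, h⟩

theorem ceil_eq_level_ancestor {s : ℝ} (h : s ≤ T.level v) : ⌈s⌉₊ = T.level (T.ancestor v ⌈s⌉₊) :=
  (T.level_ancestor_of_le (Nat.ceil_le.2 h)).symm

theorem eq_of_rootPath_eq {s t : ℝ} (hs : s ∈ Icc (0 : ℝ) (T.level v))
    (ht : t ∈ Icc (0 : ℝ) (T.level w)) (h : T.rootPath v s = T.rootPath w t) :
    s = t ∧ T.ancestor v ⌈s⌉₊ = T.ancestor w ⌈t⌉₊ := by
  have hvs := T.ceil_eq_level_ancestor hs.2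
  have hwt := T.ceil_eq_level_ancestor ht.2
  have hvw := T.eq_of_edgePoint_eq hvs hwt h
  refine ⟨T.edgePoint_injOn _ ⟨hs.1, hvs⟩ ⟨ht.1, hwt.trans (congrArg _ hvw.symm)⟩ ?_, hvw⟩
  rwa [rootPath, rootPath, ← hvw] at h

theorem rootPath_eq_of_le {s t : ℝ} (hv : s ∈ Icc (0 : ℝ) (T.level v))
    (hw : s ∈ Icc (0 : ℝ) (T.level w)) (h : T.rootPath v s = T.rootPath w s) (hts : t ≤ s) :
    T.rootPath v t = T.rootPath w t := by
  have hceil := Nat.ceil_mono hts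
  rw [rootPath, rootPath, ← T.ancestor_ancestor v hceil, (T.eq_of_rootPath_eq hv hw h).2,
    T.ancestor_ancestor w hceil]

end LeveledTree

/-! ### The metric of a rooted tree -/

namespace LeveledTree

open MetricGraph

variable {V : Type v} (T : LeveledTree V) {v : V} {n : ℕ} {p q r : T.Realisation} {s t : ℝ}

/-- A vertex `v` such that `p` lies on the geodesic from the root to `v`. -/
noncomputable def top (p : T.Realisation) : V :=
  (T.exists_rootPath_eq p).choose

/-- The height of `p`, which turns out to be its distance from the root. -/
noncomputable def height (p : T.Realisation) : ℝ :=
  (T.exists_rootPath_eq p).choose_spec.choose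

theorem height_mem_Icc (p : T.Realisation) : T.height p ∈ Icc (0 : ℝ) (T.level (T.top p)) :=
  (T.exists_rootPath_eq p).choose_spec.choose_spec.1

theorem height_nonneg (p : T.Realisation) : 0 ≤ T.height p :=
  (T.height_mem_Icc p).1

theorem rootPath_top_height (p : T.Realisation) : T.rootPath (T.top p) (T.height p) = p :=
  (T.exists_rootPath_eq p).choose_spec.choose_spec.2

theorem height_rootPath (hs : s ∈ Icc (0 : ℝ) (T.level v)) : T.height (T.rootPath v s) = s :=
  (T.eq_of_rootPath_eq (T.height_mem_Icc _) hs (T.rootPath_top_height _)).1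

theorem height_vertex (v : V) : T.height (vertex _ v) = T.level v := by
  rw [← T.ancestor_of_level_le (v := v) le_rfl, ← rootPath_natCast,
    T.height_rootPath ⟨Nat.cast_nonneg _, le_rfl⟩, T.ancestor_of_level_le le_rfl]

/-- The point of height `s` on the geodesic from the root to `p`, where heights outside
`[0, height p]` are clamped to that interval. -/
noncomputable def below (p : T.Realisation) (s : ℝ) : T.Realisation :=
  T.rootPath (T.top p) (min s (T.height p))

theorem below_of_height_le (h : T.height p ≤ s) : T.below p s = p := by
  rw [below, min_eq_right h, rootPath_top_height]

theorem below_of_nonpos (h : s ≤ 0) : T.below p s = vertex _ T.root := by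
  rw [below, rootPath_of_nonpos _ _ ((min_le_left _ _).trans h)]

theorem below_natCast (h : n ≤ T.height p) :
    T.below p n = vertex _ (T.ancestor (T.top p) n) := by
  rw [below, min_eq_left h, rootPath_natCast]

theorem min_height_mem_Icc (p : T.Realisation) (hs : 0 ≤ s) :
    min s (T.height p) ∈ Icc (0 : ℝ) (T.level (T.top p)) :=
  ⟨le_min hs (T.height_nonneg p), (min_le_right _ _).trans (T.height_mem_Icc p).2⟩

theorem height_below (hs : 0 ≤ s) : T.height (T.below p s) = min s (T.height p) :=
  T.height_rootPath (T.min_height_mem_Icc p hs)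

theorem below_rootPath (hs : s ∈ Icc (0 : ℝ) (T.level v)) :
    T.below (T.rootPath v s) t = T.rootPath v (min t s) := by
  have htop := T.rootPath_top_height (T.rootPath v s)
  have hmem := T.height_mem_Icc (T.rootPath v s)
  rw [T.height_rootPath hs] at htop hmem
  rw [below, T.height_rootPath hs]
  exact T.rootPath_eq_of_le hmem hs htop (min_le_right _ _)

theorem below_below (hs : 0 ≤ s) : T.below (T.below p s) t = T.below p (min t s) := by
  rw [below.eq_def T p s, T.below_rootPath (T.min_height_mem_Icc p hs), below, min_assoc]

theorem below_eq_of_le (h : T.below p s = T.below q s) (hts : t ≤ s) :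
    T.below p t = T.below q t := by
  rcases le_total 0 s with hs | hs
  · rw [← min_eq_left hts, ← T.below_below hs, h, T.below_below hs]
  · rw [T.below_of_nonpos (hts.trans hs), T.below_of_nonpos (hts.trans hs)]

theorem lipschitzWith_below (p : T.Realisation) : LipschitzWith 1 (T.below p) := by
  have h := (T.lipschitzWith_rootPath (T.top p)).comp (LipschitzWith.id.min_const (T.height p))
  rwa [one_mul] at h

/-- The height of the point at which the geodesics from the root to `p` and to `q` separate. -/
noncomputable def meetHeight (p q : T.Realisation) : ℝ :=
  sSup {s | s ≤ T.height p ∧ s ≤ T.height q ∧ T.below p s = T.below q s}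

theorem le_meetHeight_iff :
    s ≤ T.meetHeight p q ↔ s ≤ T.height p ∧ s ≤ T.height q ∧ T.below p s = T.below q s := by
  have hbdd : BddAbove {s | s ≤ T.height p ∧ s ≤ T.height q ∧ T.below p s = T.below q s} :=
    ⟨T.height p, fun s hs => hs.1⟩
  have hclosed : IsClosed {s | s ≤ T.height p ∧ s ≤ T.height q ∧ T.below p s = T.below q s} :=
    isClosed_Iic.inter (isClosed_Iic.inter
      (isClosed_eq (T.lipschitzWith_below p).continuous (T.lipschitzWith_below q).continuous))
  refine ⟨fun h => ?_, fun h => le_csSup hbdd h⟩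
  obtain ⟨hp, hq, hpq⟩ := hclosed.csSup_mem ⟨0, T.height_nonneg p, T.height_nonneg q, by
    rw [T.below_of_nonpos le_rfl, T.below_of_nonpos le_rfl]⟩ hbdd
  exact ⟨h.trans hp, h.trans hq, T.below_eq_of_le hpq h⟩

theorem meetHeight_le_left (p q : T.Realisation) : T.meetHeight p q ≤ T.height p :=
  (T.le_meetHeight_iff.1 le_rfl).1

theorem meetHeight_le_right (p q : T.Realisation) : T.meetHeight p q ≤ T.height q :=
  (T.le_meetHeight_iff.1 le_rfl).2.1

theorem below_meetHeight (p q : T.Realisation) :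
    T.below p (T.meetHeight p q) = T.below q (T.meetHeight p q) :=
  (T.le_meetHeight_iff.1 le_rfl).2.2

theorem meetHeight_nonneg (p q : T.Realisation) : 0 ≤ T.meetHeight p q :=
  T.le_meetHeight_iff.2 ⟨T.height_nonneg p, T.height_nonneg q, by
    rw [T.below_of_nonpos le_rfl, T.below_of_nonpos le_rfl]⟩

theorem min_meetHeight_le (p q r : T.Realisation) :
    min (T.meetHeight p q) (T.meetHeight q r) ≤ T.meetHeight p r := by
  obtain ⟨hp, -, hpq⟩ := T.le_meetHeight_iff.1 (min_le_left (T.meetHeight p q) (T.meetHeight q r))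
  obtain ⟨-, hr, hqr⟩ := T.le_meetHeight_iff.1 (min_le_right (T.meetHeight p q) (T.meetHeight q r))
  exact T.le_meetHeight_iff.2 ⟨hp, hr, hpq.trans hqr⟩

theorem min_le_meetHeight_rootPath (hs : s ∈ Icc (0 : ℝ) (T.level v))
    (ht : t ∈ Icc (0 : ℝ) (T.level v)) :
    min s t ≤ T.meetHeight (T.rootPath v s) (T.rootPath v t) := by
  rw [le_meetHeight_iff, T.height_rootPath hs, T.height_rootPath ht, T.below_rootPath hs,
    T.below_rootPath ht]
  refine ⟨min_le_left _ _, min_le_right _ _, ?_⟩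
  rw [min_eq_left (min_le_left s t), min_eq_left (min_le_right s t)]

theorem le_length_of_hasPath {L : ℝ} (h : HasPath p q L) :
    T.height p + T.height q - 2 * T.meetHeight p q ≤ L := by
  induction h with
  | nil p =>
    have : T.height p ≤ T.meetHeight p p := T.le_meetHeight_iff.2 ⟨le_rfl, le_rfl, rfl⟩
    linarith
  | @cons p q r L a b hp hq _ ih =>
    obtain ⟨u, s, hs, t, ht, rfl, rfl, hst⟩ := T.exists_rootPath_of_onEdge hp hq
    have hmeet := T.min_le_meetHeight_rootPath hs ht
    have hle := T.meetHeight_le_left (T.rootPath u t) r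
    have hultra := T.min_meetHeight_le (T.rootPath u s) (T.rootPath u t) r
    rw [hst]
    rw [T.height_rootPath ht] at ih hle
    rw [T.height_rootPath hs]
    rcases min_choice s t with h | h <;> rcases min_le_iff.1 hultra with h' | h' <;>
      rw [h] at hmeet <;> linarith [le_abs_self (s - t), neg_abs_le (s - t), min_le_left s t,
        min_le_right s t]

theorem dist_below_le_sub (hs : s ≤ T.height p) : dist p (T.below p s) ≤ T.height p - s := by
  have h := (T.lipschitzWith_below p).dist_le_mul (T.height p) s
  rwa [T.below_of_height_le le_rfl, NNReal.coe_one, one_mul, Real.dist_eq,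
    abs_of_nonneg (sub_nonneg.2 hs)] at h

theorem dist_eq_height (p q : T.Realisation) :
    dist p q = T.height p + T.height q - 2 * T.meetHeight p q := by
  refine le_antisymm ?_ (le_pathDist fun L => T.le_length_of_hasPath)
  have hp := T.dist_below_le_sub (T.meetHeight_le_left p q)
  have hq := T.dist_below_le_sub (T.meetHeight_le_right p q)
  rw [← T.below_meetHeight, dist_comm] at hq
  linarith [dist_triangle p (T.below p (T.meetHeight p q)) q]

theorem meetHeight_comm (p q : T.Realisation) : T.meetHeight p q = T.meetHeight q p := by
  linarith [T.dist_eq_height p q, T.dist_eq_height q p, dist_comm p q]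

theorem isZeroHyperbolic : IsZeroHyperbolic T.Realisation := by
  intro x y z w
  have hxy₁ := T.min_meetHeight_le x z y
  have hxy₂ := T.min_meetHeight_le x w y
  have hzw₁ := T.min_meetHeight_le z x w
  have hzw₂ := T.min_meetHeight_le z y w
  rw [T.meetHeight_comm z y] at hxy₁ hzw₂
  rw [T.meetHeight_comm w y] at hxy₂
  rw [T.meetHeight_comm z x] at hzw₁
  simp only [dist_eq_height]
  by_contra! h
  obtain ⟨h₁, h₂⟩ := max_lt_iff.1 h
  rcases min_le_iff.1 hxy₁ with _ | _ <;> rcases min_le_iff.1 hxy₂ with _ | _ <;>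
    rcases min_le_iff.1 hzw₁ with _ | _ <;> rcases min_le_iff.1 hzw₂ with _ | _ <;> linarith

theorem height_sub_dist_le_meetHeight (p q : T.Realisation) :
    T.height p - dist p q ≤ T.meetHeight p q := by
  linarith [T.dist_eq_height p q, T.meetHeight_le_right p q]

theorem dist_below (hs : 0 ≤ s) (hsp : s ≤ T.height p) :
    dist p (T.below p s) = T.height p - s := by
  refine (T.dist_below_le_sub hsp).antisymm ?_
  have hmeet := T.meetHeight_le_right p (T.below p s)
  have hdist := T.dist_eq_height p (T.below p s)
  rw [T.height_below hs, min_eq_left hsp] at hmeet hdist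
  linarith

theorem dist_root (p : T.Realisation) : dist p (vertex _ T.root) = T.height p := by
  rw [← T.below_of_nonpos (p := p) le_rfl, T.dist_below le_rfl (T.height_nonneg p), sub_zero]

theorem isGeodesicFromTo_below (hs : 0 ≤ s) (hsp : s ≤ T.height p) :
    IsGeodesicFromTo (fun t => T.below p (s + t)) (T.below p s) p := by
  refine .of_lipschitzOnWith (by rw [add_zero]) ?_ (.of_dist_le_mul fun t _ t' _ => ?_)
  · rw [dist_comm, T.dist_below hs hsp, add_sub_cancel, T.below_of_height_le le_rfl]
  · rw [← dist_add_left s t t']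
    exact (T.lipschitzWith_below p).dist_le_mul _ _

theorem isGeodesicSpace : IsGeodesicSpace T.Realisation := by
  intro p q
  have hm := T.meetHeight_nonneg p q
  have hp := T.meetHeight_le_left p q
  have hq := T.meetHeight_le_right p q
  have hgeod := T.isGeodesicFromTo_below hm hq
  rw [← T.below_meetHeight] at hgeod
  refine ⟨_, (T.isGeodesicFromTo_below hm hp).symm.trans hgeod ?_⟩
  rw [T.dist_below hm hp, T.below_meetHeight, dist_comm _ q, T.dist_below hm hq, dist_eq_height]
  ring

theorem isRTree : IsRTree T.Realisation :=
  T.isZeroHyperbolic.isRTree T.isGeodesicSpace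

end LeveledTree

/-! ### Change of the base point -/

section ChangeOfBasePoint

variable {Y : Type u} [MetricSpace Y] {y₀ y₁ : Y}

theorem InSamePathComponent.joinedIn {r : ℝ} {A B : Set Y} {a b : Y}
    (h : InSamePathComponent y₀ r A B) (ha : a ∈ A) (hb : b ∈ B) :
    JoinedIn (closedBall y₀ r)ᶜ a b := by
  obtain ⟨z, -, hA, hB⟩ := h
  exact (hA ha : JoinedIn _ z a).symm.trans (hB hb)

theorem InSamePathComponent.mono_closedBall {r s : ℝ} {A B : Set Y}
    (h : InSamePathComponent y₀ r A B) (hsub : closedBall y₁ s ⊆ closedBall y₀ r) :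
    InSamePathComponent y₁ s A B := by
  obtain ⟨z, hz, hA, hB⟩ := h
  have hsub' := compl_subset_compl.2 hsub
  exact ⟨z, hsub' hz, hA.trans (pathComponentIn_mono hsub'), hB.trans (pathComponentIn_mono hsub')⟩

theorem SpaceOfEnds.continuous_of_convergesTo {Z : Type v} [MetricSpace Z] {z₀ : Z}
    {f : SpaceOfEnds Y y₀ → SpaceOfEnds Z z₀}
    (hf : ∀ e e', ConvergesTo e e' → ConvergesTo (f ∘ e) (f e')) : Continuous f :=
  continuous_iff_isClosed.2 fun C hC =>
    (isClosed_iff _).2 fun _ _ he h => (isClosed_iff C).1 hC _ _ he (hf _ _ h)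

/-- A proper ray, regarded as a proper ray with respect to the base point `y₁`. -/
def ProperRay.changeBase (y₁ : Y) (γ : ProperRay Y y₀) : ProperRay Y y₁ where
  toFun := γ.toFun
  continuous_toFun := γ.continuous_toFun
  isBounded_preimage r hr := (γ.isBounded_preimage (r + dist y₁ y₀) (by positivity)).subset
    (preimage_mono (closedBall_subset_closedBall' le_rfl))

theorem ProperRay.SameEnd.changeBase {γ γ' : ProperRay Y y₀} (h : γ.SameEnd γ') (y₁ : Y) :
    (γ.changeBase y₁).SameEnd (γ'.changeBase y₁) := fun r hr =>
  (h (r + dist y₁ y₀) (by positivity)).imp fun _ ht =>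
    ht.mono_closedBall (closedBall_subset_closedBall' le_rfl)

/-- The map of spaces of ends induced by a change of the base point. -/
def SpaceOfEnds.changeBase (y₀ y₁ : Y) : SpaceOfEnds Y y₀ → SpaceOfEnds Y y₁ :=
  Quotient.map (ProperRay.changeBase y₁) fun _ _ h => ProperRay.SameEnd.changeBase h y₁

theorem SpaceOfEnds.changeBase_changeBase (y₀ y₁ : Y) (e : SpaceOfEnds Y y₀) :
    changeBase y₁ y₀ (changeBase y₀ y₁ e) = e := by
  induction e using Quotient.inductionOn with
  | h γ => rfl

theorem SpaceOfEnds.ConvergesTo.changeBase {e : ℕ → SpaceOfEnds Y y₀} {e' : SpaceOfEnds Y y₀}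
    (h : ConvergesTo e e') (y₁ : Y) :
    ConvergesTo (SpaceOfEnds.changeBase y₀ y₁ ∘ e) (SpaceOfEnds.changeBase y₀ y₁ e') := by
  obtain ⟨γ, γ', hγ, hγ', htails⟩ := h
  refine ⟨fun n => (γ n).changeBase y₁, γ'.changeBase y₁,
    fun n => congrArg (SpaceOfEnds.changeBase y₀ y₁) (hγ n),
    congrArg (SpaceOfEnds.changeBase y₀ y₁) hγ', fun r _ => ?_⟩
  obtain ⟨N, hN⟩ := htails (r + dist y₁ y₀) (by positivity)
  exact ⟨N, hN.mono fun n hn => hn.mono_closedBall (closedBall_subset_closedBall' le_rfl)⟩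

/-- The canonical homeomorphism between the spaces of ends of `Y` for two base points. -/
def SpaceOfEnds.changeBaseHomeomorph (y₀ y₁ : Y) : SpaceOfEnds Y y₀ ≃ₜ SpaceOfEnds Y y₁ where
  toFun := changeBase y₀ y₁
  invFun := changeBase y₁ y₀
  left_inv := changeBase_changeBase y₀ y₁
  right_inv := changeBase_changeBase y₁ y₀
  continuous_toFun := continuous_of_convergesTo fun _ _ h => h.changeBase y₁
  continuous_invFun := continuous_of_convergesTo fun _ _ h => h.changeBase y₀

end ChangeOfBasePoint

/-! ### Ends as branches of a tree -/

section Concatenation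

variable {Y : Type*} [TopologicalSpace Y] {y : ℕ → Y}

/-- The concatenation of infinitely many paths, the `n`-th of which is run through during
`[n, n + 1]`. -/
noncomputable def concatPaths (σ : ∀ n, Path (y n) (y (n + 1))) (t : ℝ≥0) : Y :=
  (σ ⌊t⌋₊).extend ((t : ℝ) - ⌊t⌋₊)

theorem concatPaths_eq_extend (σ : ∀ n, Path (y n) (y (n + 1))) {n : ℕ} {t : ℝ≥0}
    (ht : t ∈ Icc (n : ℝ≥0) (n + 1)) : concatPaths σ t = (σ n).extend ((t : ℝ) - n) := by
  rcases ht.2.eq_or_lt with h | h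
  · obtain rfl : t = ((n + 1 : ℕ) : ℝ≥0) := by rw [h, Nat.cast_succ]
    rw [concatPaths, Nat.floor_natCast]
    simp
  · rw [concatPaths, (Nat.floor_eq_iff zero_le).2 ⟨ht.1, h⟩]

theorem concatPaths_natCast (σ : ∀ n, Path (y n) (y (n + 1))) (n : ℕ) :
    concatPaths σ n = y n := by
  simp [concatPaths]

theorem continuous_concatPaths (σ : ∀ n, Path (y n) (y (n + 1))) : Continuous (concatPaths σ) := by
  have hfin : LocallyFinite fun n : ℕ => Icc (n : ℝ≥0) (n + 1) := fun t => by
    refine ⟨Iio (⌊t⌋₊ + 1), Iio_mem_nhds (Nat.lt_floor_add_one t),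
      (finite_Iic ⌊t⌋₊).subset ?_⟩
    rintro n ⟨s, hns, hst⟩
    have hn : (n : ℝ≥0) < ⌊t⌋₊ + 1 := hns.1.trans_lt hst
    exact Nat.lt_succ_iff.1 (by exact_mod_cast hn)
  refine hfin.continuous ?_ (fun _ => isClosed_Icc) fun n => ?_
  · exact eq_univ_of_forall fun t =>
      mem_iUnion.2 ⟨⌊t⌋₊, Nat.floor_le zero_le, (Nat.lt_floor_add_one t).le⟩
  · exact ContinuousOn.congr (by fun_prop) fun t ht => concatPaths_eq_extend σ ht

theorem exists_continuous_of_joinedIn {F : ℕ → Set Y}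
    (h : ∀ n, JoinedIn (F n) (y n) (y (n + 1))) :
    ∃ γ : ℝ≥0 → Y, Continuous γ ∧ (∀ n : ℕ, γ n = y n) ∧ ∀ t, γ t ∈ F ⌊t⌋₊ := by
  refine ⟨concatPaths fun n => (h n).somePath, continuous_concatPaths _, concatPaths_natCast _,
    fun t => ?_⟩
  have hle : ((⌊t⌋₊ : ℝ≥0) : ℝ) ≤ t := NNReal.coe_le_coe.2 (Nat.floor_le zero_le)
  have hlt : (t : ℝ) < ((⌊t⌋₊ + 1 : ℝ≥0) : ℝ) := NNReal.coe_lt_coe.2 (Nat.lt_floor_add_one t)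
  push_cast at hle hlt
  rw [concatPaths, Path.extend_apply _ ⟨by linarith, by linarith⟩]
  exact (h ⌊t⌋₊).somePath_mem _

end Concatenation

theorem isPathConnected_Ici_nnreal (t : ℝ≥0) : IsPathConnected (Ici t) := by
  have himage : Real.toNNReal '' Ici (t : ℝ) = Ici t := by
    refine Subset.antisymm (image_subset_iff.2 fun x hx => NNReal.le_toNNReal_of_coe_le hx)
      fun s hs => ⟨s, NNReal.coe_le_coe.2 hs, Real.toNNReal_coe⟩
  rw [← himage]
  exact ((convex_Ici (t : ℝ)).isPathConnected nonempty_Ici).image continuous_real_toNNReal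

section ProperRays

variable {Y : Type u} [MetricSpace Y] {y₀ : Y} {r : ℝ}

theorem compl_closedBall_subset_compl_closedBall {s : ℝ} (h : s ≤ r) :
    (closedBall y₀ r)ᶜ ⊆ (closedBall y₀ s)ᶜ :=
  compl_subset_compl.2 (closedBall_subset_closedBall h)

theorem ProperRay.joinedIn_of_forall_ge (γ : ProperRay Y y₀) {F : Set Y} {t s s' : ℝ≥0}
    (h : ∀ s, t ≤ s → γ.toFun s ∈ F) (hs : t ≤ s) (hs' : t ≤ s') :
    JoinedIn F (γ.toFun s) (γ.toFun s') :=
  (((isPathConnected_Ici_nnreal t).image γ.continuous_toFun).joinedIn _ ⟨s, hs, rfl⟩ _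
    ⟨s', hs', rfl⟩).mono (image_subset_iff.2 h)

theorem ProperRay.exists_of_joinedIn {y : ℕ → Y}
    (h : ∀ n : ℕ, JoinedIn (closedBall y₀ ((n : ℝ) - 1))ᶜ (y n) (y (n + 1))) :
    ∃ γ : ProperRay Y y₀, (∀ n : ℕ, γ.toFun n = y n) ∧
      ∀ (n : ℕ) (t : ℝ≥0), n ≤ t → γ.toFun t ∈ (closedBall y₀ ((n : ℝ) - 1))ᶜ := by
  obtain ⟨γ, hγ, hγn, hγF⟩ := exists_continuous_of_joinedIn h
  have htail : ∀ (n : ℕ) (t : ℝ≥0), n ≤ t → γ t ∈ (closedBall y₀ ((n : ℝ) - 1))ᶜ := fun n t hnt =>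
    compl_closedBall_subset_compl_closedBall
      (sub_le_sub_right (Nat.cast_le.2 (Nat.le_floor hnt)) 1) (hγF t)
  refine ⟨⟨γ, hγ, fun r _ => ?_⟩, hγn, htail⟩
  obtain ⟨n, hn⟩ := exists_nat_ge (r + 1)
  refine (isBounded_Icc (0 : ℝ≥0) n).subset fun t ht => ⟨zero_le, ?_⟩
  by_contra! hnt
  exact htail n t hnt.le (closedBall_subset_closedBall (by linarith) ht)

end ProperRays

/-- An infinite ascending path from the root. -/
@[ext]
structure LeveledTree.Branch {V : Type v} (T : LeveledTree V) where
  vertex : ℕ → V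
  level_vertex : ∀ n, T.level (vertex n) = n
  parent_vertex : ∀ n, T.parent (vertex (n + 1)) = vertex n

/-- An identification of the vertices of level `n` of `T` with the path components of the complement
of the closed ball of radius `n - 1` in `Y` that contain points at distance at least `n` from the
base point, under which the parent of a component is the component that contains it. The ball is
smaller than the distance `n` so that points with the same label are joined in its complement, and
it is empty for `n = 0`. -/
structure ComponentLabelling {V : Type v} (T : LeveledTree V) (Y : Type u) [MetricSpace Y]
    (y₀ : Y) where
  comp : ∀ (n : ℕ) (y : Y), n ≤ dist y y₀ → V
  level_comp : ∀ n y h, T.level (comp n y h) = n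
  exists_comp_eq : ∀ v, ∃ y h, comp (T.level v) y h = v
  comp_eq_iff : ∀ {n y y' h h'},
    comp n y h = comp n y' h' ↔ JoinedIn (closedBall y₀ ((n : ℝ) - 1))ᶜ y y'
  parent_comp : ∀ n y h h', T.parent (comp (n + 1) y h) = comp n y h'

namespace ComponentLabelling

variable {V : Type v} {T : LeveledTree V} {Y : Type u} [MetricSpace Y] {y₀ : Y}
  (S : ComponentLabelling T Y y₀) {γ γ' : ProperRay Y y₀} {n : ℕ}

theorem exists_eventually_comp_eq (γ : ProperRay Y y₀) (n : ℕ) :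
    ∃ v, ∀ᶠ s in atTop, ∃ h, S.comp n (γ.toFun s) h = v := by
  obtain ⟨t, ht⟩ := γ.exists_tail n n.cast_nonneg
  have hle : ∀ s, t ≤ s → (n : ℝ) ≤ dist (γ.toFun s) y₀ := fun s hs =>
    (not_le.1 (mt mem_closedBall.2 (ht s hs))).le
  refine ⟨S.comp n (γ.toFun t) (hle t le_rfl), (eventually_ge_atTop t).mono fun s hs =>
    ⟨hle s hs, S.comp_eq_iff.2 ((γ.joinedIn_of_forall_ge ht hs le_rfl).mono ?_)⟩⟩
  exact compl_closedBall_subset_compl_closedBall (sub_le_self _ zero_le_one)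

/-- The branch of the components that contain a tail of `γ`. -/
noncomputable def rayBranch (γ : ProperRay Y y₀) : T.Branch where
  vertex n := (S.exists_eventually_comp_eq γ n).choose
  level_vertex n := by
    obtain ⟨s, h, hs⟩ := (S.exists_eventually_comp_eq γ n).choose_spec.exists
    rw [← hs, S.level_comp]
  parent_vertex n := by
    obtain ⟨s, ⟨h, hs⟩, h', hs'⟩ := ((S.exists_eventually_comp_eq γ n).choose_spec.and
      (S.exists_eventually_comp_eq γ (n + 1)).choose_spec).exists
    rw [← hs, ← hs', S.parent_comp]

theorem eventually_comp_eq_rayBranch (γ : ProperRay Y y₀) (n : ℕ) :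
    ∀ᶠ s in atTop, ∃ h, S.comp n (γ.toFun s) h = (S.rayBranch γ).vertex n :=
  (S.exists_eventually_comp_eq γ n).choose_spec

theorem rayBranch_vertex_eq_iff :
    (S.rayBranch γ).vertex n = (S.rayBranch γ').vertex n ↔
      ∃ t, InSamePathComponent y₀ ((n : ℝ) - 1) (γ.toFun '' Ici t) (γ'.toFun '' Ici t) := by
  have hev := (S.eventually_comp_eq_rayBranch γ n).and (S.eventually_comp_eq_rayBranch γ' n)
  constructor
  · intro heq
    obtain ⟨t, ht⟩ := eventually_atTop.1 hev
    obtain ⟨⟨h, hcomp⟩, -⟩ := ht t le_rfl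
    refine ⟨t, γ.toFun t, fun hmem => by linarith [mem_closedBall.1 hmem], ?_, ?_⟩
    · refine image_subset_iff.2 fun s hs => ?_
      obtain ⟨⟨h', hcomp'⟩, -⟩ := ht s hs
      exact S.comp_eq_iff.1 (hcomp.trans hcomp'.symm)
    · refine image_subset_iff.2 fun s hs => ?_
      obtain ⟨-, h', hcomp'⟩ := ht s hs
      exact S.comp_eq_iff.1 (hcomp.trans (heq.trans hcomp'.symm))
  · rintro ⟨t, ht⟩
    obtain ⟨s, ⟨⟨h, hcomp⟩, h', hcomp'⟩, hs⟩ := (hev.and (eventually_ge_atTop t)).exists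
    rw [← hcomp, ← hcomp', S.comp_eq_iff]
    exact ht.joinedIn ⟨s, hs, rfl⟩ ⟨s, hs, rfl⟩

theorem rayBranch_eq_iff : S.rayBranch γ = S.rayBranch γ' ↔ γ.SameEnd γ' := by
  constructor
  · intro h r _
    obtain ⟨n, hn⟩ := exists_nat_ge (r + 1)
    obtain ⟨t, ht⟩ := S.rayBranch_vertex_eq_iff.1 (congrArg (LeveledTree.Branch.vertex · n) h)
    exact ⟨t, ht.mono_closedBall (closedBall_subset_closedBall (by linarith))⟩
  · intro h
    ext n
    obtain ⟨t, ht⟩ := h n n.cast_nonneg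
    exact S.rayBranch_vertex_eq_iff.2
      ⟨t, ht.mono_closedBall (closedBall_subset_closedBall (sub_le_self _ zero_le_one))⟩

theorem rayBranch_surjective : Function.Surjective S.rayBranch := by
  intro b
  have hex : ∀ n, ∃ y h, S.comp n y h = b.vertex n := fun n => by
    simpa only [b.level_vertex] using S.exists_comp_eq (b.vertex n)
  choose y hy hyb using hex
  have hle : ∀ n : ℕ, (n : ℝ) ≤ dist (y (n + 1)) y₀ := fun n =>
    (Nat.cast_le.2 n.le_succ).trans (hy (n + 1))
  have hjoin : ∀ n : ℕ, JoinedIn (closedBall y₀ ((n : ℝ) - 1))ᶜ (y n) (y (n + 1)) := fun n => by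
    rw [← S.comp_eq_iff (h := hy n) (h' := hle n), hyb, ← S.parent_comp n _ (hy (n + 1)), hyb,
      b.parent_vertex]
  obtain ⟨γ, hγ, htail⟩ := ProperRay.exists_of_joinedIn hjoin
  refine ⟨γ, LeveledTree.Branch.ext (funext fun n => ?_)⟩
  obtain ⟨s, ⟨h, hcomp⟩, hs⟩ :=
    ((S.eventually_comp_eq_rayBranch γ n).and (eventually_ge_atTop (n : ℝ≥0))).exists
  rw [← hcomp, ← hyb n, S.comp_eq_iff, ← hγ n]
  exact γ.joinedIn_of_forall_ge (htail n) hs le_rfl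

/-- The bijection between the ends of `Y` and the branches of the tree that labels its
components. -/
noncomputable def endEquivBranch : SpaceOfEnds Y y₀ ≃ T.Branch :=
  Equiv.ofBijective (Quotient.lift S.rayBranch fun _ _ h => S.rayBranch_eq_iff.2 h) <| by
    refine ⟨fun e e' => ?_, Quotient.lift_surjective _ _ S.rayBranch_surjective⟩
    induction e, e' using Quotient.inductionOn₂ with
    | h γ γ' => exact fun h => Quotient.sound (S.rayBranch_eq_iff.1 h)

theorem endEquivBranch_toEnd (γ : ProperRay Y y₀) :
    S.endEquivBranch γ.toEnd = S.rayBranch γ := rfl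

theorem convergesTo_iff {e : ℕ → SpaceOfEnds Y y₀} {e' : SpaceOfEnds Y y₀} :
    SpaceOfEnds.ConvergesTo e e' ↔ ∀ n, ∀ᶠ k in atTop,
      (S.endEquivBranch (e k)).vertex n = (S.endEquivBranch e').vertex n := by
  constructor
  · rintro ⟨γ, γ', hγ, rfl, htails⟩ n
    obtain ⟨N, hN⟩ := htails n n.cast_nonneg
    refine hN.mono fun k hk => ?_
    rw [← hγ, endEquivBranch_toEnd, endEquivBranch_toEnd, S.rayBranch_vertex_eq_iff]
    exact ⟨N k,
      hk.mono_closedBall (closedBall_subset_closedBall (sub_le_self _ zero_le_one))⟩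
  · intro h
    choose γ hγ using fun k => Quotient.exists_rep (e k)
    obtain ⟨γ', rfl⟩ := Quotient.exists_rep e'
    refine ⟨γ, γ', hγ, rfl, fun r _ => ?_⟩
    obtain ⟨n, hn⟩ := exists_nat_ge (r + 1)
    suffices htail : ∀ᶠ k in atTop, ∃ t,
        InSamePathComponent y₀ r ((γ k).toFun '' Ici t) (γ'.toFun '' Ici t) from htail.choice
    filter_upwards [h n] with k hk
    rw [← hγ] at hk
    obtain ⟨t, ht⟩ := S.rayBranch_vertex_eq_iff.1 hk
    exact ⟨t, ht.mono_closedBall (closedBall_subset_closedBall (by linarith))⟩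

/-- Spaces whose components are labelled by the same tree have homeomorphic spaces of ends. -/
noncomputable def homeomorph {Z : Type*} [MetricSpace Z] {z₀ : Z}
    (S : ComponentLabelling T Y y₀) (S' : ComponentLabelling T Z z₀) :
    SpaceOfEnds Y y₀ ≃ₜ SpaceOfEnds Z z₀ where
  toEquiv := S.endEquivBranch.trans S'.endEquivBranch.symm
  continuous_toFun := SpaceOfEnds.continuous_of_convergesTo fun e e' h => by
    rw [S'.convergesTo_iff]
    simpa using S.convergesTo_iff.1 h
  continuous_invFun := SpaceOfEnds.continuous_of_convergesTo fun e e' h => by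
    rw [S.convergesTo_iff]
    simpa using S'.convergesTo_iff.1 h

end ComponentLabelling

/-! ### The components of a rooted tree -/

namespace LeveledTree

open MetricGraph

variable {V : Type v} (T : LeveledTree V) {n : ℕ} {p q : T.Realisation}

theorem mem_compl_closedBall_root {r : ℝ} : p ∈ (closedBall (vertex _ T.root) r)ᶜ ↔
    r < T.height p := by
  rw [mem_compl_iff, mem_closedBall, dist_root, not_le]

theorem joinedIn_below (h : n ≤ T.height p) :
    JoinedIn (closedBall (vertex _ T.root) ((n : ℝ) - 1))ᶜ p (T.below p n) := by
  have hpath := ((convex_Icc (n : ℝ) (T.height p)).isPathConnected (nonempty_Icc.2 h)).image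
    (T.lipschitzWith_below p).continuous
  refine (hpath.joinedIn _ ⟨T.height p, right_mem_Icc.2 h, T.below_of_height_le le_rfl⟩ _
    ⟨n, left_mem_Icc.2 h, rfl⟩).mono (image_subset_iff.2 fun s hs => ?_)
  rw [mem_preimage, mem_compl_closedBall_root, T.height_below (n.cast_nonneg.trans hs.1),
    min_eq_left hs.2]
  linarith [hs.1]

theorem ancestor_top_eq_of_lt_meetHeight (h : (n : ℝ) - 1 < T.meetHeight p q) :
    T.ancestor (T.top p) n = T.ancestor (T.top q) n := by
  have hs := min_le_left (T.meetHeight p q) n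
  have hs₀ : 0 ≤ min (T.meetHeight p q) n := le_min (T.meetHeight_nonneg p q) n.cast_nonneg
  have hceil : ⌈min (T.meetHeight p q) n⌉₊ = n := by
    refine (Nat.ceil_le.2 (min_le_right _ _)).antisymm (Nat.lt_add_one_iff.1 ?_)
    have hlt := (lt_min h (sub_one_lt _)).trans_le (Nat.le_ceil (min (T.meetHeight p q) n))
    exact_mod_cast sub_lt_iff_lt_add.1 hlt
  obtain ⟨hp, hq, heq⟩ := T.le_meetHeight_iff.1 hs
  rw [below, below, min_eq_left hp, min_eq_left hq] at heq
  have hanc := (T.eq_of_rootPath_eq ⟨hs₀, hp.trans (T.height_mem_Icc p).2⟩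
    ⟨hs₀, hq.trans (T.height_mem_Icc q).2⟩ heq).2
  rwa [hceil] at hanc

theorem ancestor_top_eq_of_joinedIn
    (h : JoinedIn (closedBall (vertex _ T.root) ((n : ℝ) - 1))ᶜ p q) :
    T.ancestor (T.top p) n = T.ancestor (T.top q) n := by
  obtain ⟨σ, hσ⟩ := h
  have hloc : IsLocallyConstant fun t => T.ancestor (T.top (σ t)) n := by
    refine (IsLocallyConstant.iff_eventually_eq _).2 fun t => ?_
    have hpos : 0 < T.height (σ t) - ((n : ℝ) - 1) :=
      sub_pos.2 (T.mem_compl_closedBall_root.1 (hσ t))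
    filter_upwards [σ.continuous.continuousAt.eventually_mem (ball_mem_nhds (σ t) hpos)]
      with t' ht'
    refine (T.ancestor_top_eq_of_lt_meetHeight ?_).symm
    linarith [mem_ball'.1 ht', T.height_sub_dist_le_meetHeight (σ t) (σ t')]
  simpa only [σ.source, σ.target] using hloc.apply_eq_of_preconnectedSpace 0 1

theorem ancestor_top_vertex (v : V) :
    T.ancestor (T.top (vertex T.graph_connected v)) (T.level v) = v := by
  refine vertex_injective (hG := T.graph_connected) ?_
  rw [← T.below_natCast (T.height_vertex v).ge, T.below_of_height_le (T.height_vertex v).le]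

/-- Outside the closed ball of radius `n - 1` around the root, the component of a point of height at
least `n` is labelled by its ancestor of level `n`. -/
noncomputable def componentLabelling :
    ComponentLabelling T T.Realisation (vertex _ T.root) where
  comp n p _ := T.ancestor (T.top p) n
  level_comp n p h := T.level_ancestor_of_le <| by
    rw [dist_root] at h
    exact_mod_cast h.trans (T.height_mem_Icc p).2
  exists_comp_eq v := ⟨vertex _ v, by rw [dist_root, height_vertex], T.ancestor_top_vertex v⟩
  comp_eq_iff {n p q h h'} := by
    rw [dist_root] at h h'
    refine ⟨fun heq => ?_, T.ancestor_top_eq_of_joinedIn⟩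
    have hp := T.joinedIn_below h
    rw [T.below_natCast h, heq, ← T.below_natCast h'] at hp
    exact hp.trans (T.joinedIn_below h').symm
  parent_comp n p h _ := T.parent_ancestor_succ <| by
    rw [dist_root] at h
    exact_mod_cast h.trans (T.height_mem_Icc p).2

end LeveledTree

/-! ### The tree of components of a space -/

section ComponentTree

variable {X : Type u} [MetricSpace X] {x₀ x : X} {n : ℕ}

theorem exists_mem_sphere_joinedIn_compl_ball [PathConnectedSpace X] {R : ℝ} (hR : 0 ≤ R)
    (h : R ≤ dist x x₀) : ∃ y ∈ sphere x₀ R, JoinedIn (ball x₀ R)ᶜ x y := by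
  let σ := PathConnectedSpace.somePath x x₀
  have hσ : Continuous fun t => dist (σ.extend t) x₀ := σ.continuous_extend.dist continuous_const
  have h₀ : R ≤ dist (σ.extend 0) x₀ := by rwa [σ.extend_zero]
  have h₁ : dist (σ.extend 1) x₀ ≤ R := by rwa [σ.extend_one, dist_self]
  obtain ⟨t, ⟨ht, hdist⟩, hleast⟩ :=
    (isCompact_Icc.inter_right (isClosed_eq hσ continuous_const)).exists_isLeast
      (intermediate_value_Icc' zero_le_one hσ.continuousOn ⟨h₁, h₀⟩)
  refine ⟨σ.extend t, hdist, ?_⟩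
  have hpath := ((convex_Icc 0 t).isPathConnected (nonempty_Icc.2 ht.1)).image σ.continuous_extend
  refine (hpath.joinedIn _ ⟨0, left_mem_Icc.2 ht.1, σ.extend_zero⟩ _
    ⟨t, right_mem_Icc.2 ht.1, rfl⟩).mono (image_subset_iff.2 fun s hs hmem => ?_)
  obtain ⟨u, hu, hudist⟩ :=
    intermediate_value_Icc' hs.1 hσ.continuousOn ⟨(mem_ball.1 hmem).le, h₀⟩
  have htu := hleast ⟨⟨hu.1, hu.2.trans (hs.2.trans ht.2)⟩, hudist⟩
  obtain rfl : s = t := hs.2.antisymm (htu.trans hu.2)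
  exact (mem_ball.1 hmem).ne hdist

theorem exists_mem_sphere_joinedIn_compl_closedBall [PathConnectedSpace X] (h : n ≤ dist x x₀) :
    ∃ y ∈ sphere x₀ (n : ℝ), JoinedIn (closedBall x₀ ((n : ℝ) - 1))ᶜ x y := by
  obtain ⟨y, hy, hxy⟩ := exists_mem_sphere_joinedIn_compl_ball n.cast_nonneg h
  exact ⟨y, hy, hxy.mono (compl_subset_compl.2 (closedBall_subset_ball (sub_one_lt _)))⟩

theorem eventually_joinedIn_of_isOpen {Y : Type*} [TopologicalSpace Y] [LocallyPathConnectedSpace Y]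
    {F : Set Y} {y : Y} (hF : IsOpen F) (hy : y ∈ F) : ∀ᶠ z in 𝓝 y, JoinedIn F y z :=
  (hF.pathComponentIn y).mem_nhds (mem_pathComponentIn_self hy)

/-- Pairs `(n, x)` with `x` at distance at least `n` from `x₀` are equivalent if they have the same
first component `n` and their second components are joined outside the closed ball of radius
`n - 1`. -/
def componentSetoid (x₀ : X) : Setoid {p : ℕ × X // p.1 ≤ dist p.2 x₀} where
  r p q := p.1.1 = q.1.1 ∧ JoinedIn (closedBall x₀ ((p.1.1 : ℝ) - 1))ᶜ p.1.2 q.1.2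
  iseqv :=
    { refl := fun p => ⟨rfl, .refl fun h => by linarith [p.2, mem_closedBall.1 h]⟩
      symm := fun h => ⟨h.1.symm, h.1 ▸ h.2.symm⟩
      trans := fun h h' => ⟨h.1.trans h'.1, h.2.trans (h.1 ▸ h'.2)⟩ }

/-- The vertices of the tree of components: those of level `n` are the path components of the
complement of the closed ball of radius `n - 1` that contain points at distance at least `n` from
`x₀`. -/
def ComponentVertex (x₀ : X) : Type u := Quotient (componentSetoid x₀)

/-- The component of `x` outside the closed ball of radius `n - 1`. -/
def ComponentVertex.mk (n : ℕ) (x : X) (h : n ≤ dist x x₀) : ComponentVertex x₀ :=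
  Quotient.mk (componentSetoid x₀) ⟨(n, x), h⟩

theorem ComponentVertex.mk_eq_iff {y : X} {hx : n ≤ dist x x₀} {hy : n ≤ dist y x₀} :
    mk n x hx = mk n y hy ↔ JoinedIn (closedBall x₀ ((n : ℝ) - 1))ᶜ x y :=
  Quotient.eq.trans (and_iff_right rfl)

/-- The tree of the components of the complements of balls around `x₀`, in which the parent of a
component is the component of the next smaller ball that contains it. -/
def componentTree [PathConnectedSpace X] (x₀ : X) : LeveledTree (ComponentVertex x₀) where
  root := ComponentVertex.mk 0 x₀ (by simp)
  parent := Quotient.map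
    (fun p => ⟨(p.1.1 - 1, p.1.2), (Nat.cast_le.2 (Nat.sub_le _ 1)).trans p.2⟩)
    fun p q h => ⟨congrArg (· - 1) h.1, h.2.mono (compl_closedBall_subset_compl_closedBall
      (sub_le_sub_right (Nat.cast_le.2 (Nat.sub_le _ 1)) 1))⟩
  level := Quotient.lift (fun p => p.1.1) fun _ _ h => h.1
  level_root := rfl
  level_parent v := by
    induction v using Quotient.inductionOn with
    | h p => rfl
  eq_root v hv := by
    induction v using Quotient.inductionOn with
    | h p =>
      obtain ⟨⟨n, x⟩, hp⟩ := p
      obtain rfl : n = 0 := hv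
      refine ComponentVertex.mk_eq_iff.2 ?_
      obtain ⟨y, hy, hxy⟩ := exists_mem_sphere_joinedIn_compl_closedBall hp
      rw [Nat.cast_zero, sphere_zero, mem_singleton_iff] at hy
      exact hy ▸ hxy

/-- The components of the complements of balls in `X` are labelled by their own tree. -/
def componentTreeLabelling [PathConnectedSpace X] (x₀ : X) :
    ComponentLabelling (componentTree x₀) X x₀ where
  comp := ComponentVertex.mk
  level_comp _ _ _ := rfl
  exists_comp_eq v := by
    induction v using Quotient.inductionOn with
    | h p => exact ⟨p.1.2, p.2, rfl⟩
  comp_eq_iff := ComponentVertex.mk_eq_iff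
  parent_comp _ _ _ _ := rfl

theorem finite_setOf_level_componentTree_eq [ProperSpace X] [PathConnectedSpace X]
    [LocallyPathConnectedSpace X] (x₀ : X) (n : ℕ) :
    {v | (componentTree x₀).level v = n}.Finite := by
  have hloc : IsLocallyConstant fun x : sphere x₀ (n : ℝ) =>
      ComponentVertex.mk n x.1 (mem_sphere.1 x.2).ge := by
    refine (IsLocallyConstant.iff_eventually_eq _).2 fun x => ?_
    have hx : x.1 ∈ (closedBall x₀ ((n : ℝ) - 1))ᶜ := fun h => by
      linarith [mem_sphere.1 x.2, mem_closedBall.1 h]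
    filter_upwards [continuous_subtype_val.continuousAt.eventually
      (eventually_joinedIn_of_isOpen isClosed_closedBall.isOpen_compl hx)] with y hy
    exact ComponentVertex.mk_eq_iff.2 hy.symm
  have := isCompact_iff_compactSpace.1 (isCompact_sphere x₀ (n : ℝ))
  refine hloc.range_finite.subset fun v hv => ?_
  induction v using Quotient.inductionOn with
  | h p =>
    obtain ⟨⟨m, x⟩, hp⟩ := p
    obtain rfl : m = n := hv
    obtain ⟨y, hy, hxy⟩ := exists_mem_sphere_joinedIn_compl_closedBall hp
    exact ⟨⟨y, hy⟩, ComponentVertex.mk_eq_iff.2 hxy.symm⟩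

end ComponentTree

/-! ### Geodesic spaces -/

section GeodesicSpaces

variable {X : Type u} [MetricSpace X]

theorem IsGeodesicSpace.isPathConnected_ball (hX : IsGeodesicSpace X) (x : X) {r : ℝ} (hr : 0 < r) :
    IsPathConnected (ball x r) := by
  refine ⟨x, mem_ball_self hr, fun {y} hy => ?_⟩
  obtain ⟨α, hα⟩ := hX x y
  refine (hα.isPathConnected_image.joinedIn _ hα.left_mem_image _ hα.right_mem_image).mono
    (image_subset_iff.2 fun s hs => ?_)
  rw [mem_preimage, mem_ball', hα.dist_left hs]
  exact hs.2.trans_lt (mem_ball'.1 hy)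

theorem IsGeodesicSpace.preconnectedSpace (hX : IsGeodesicSpace X) : PreconnectedSpace X := by
  refine ⟨isPreconnected_of_forall_pair fun x _ y _ => ?_⟩
  obtain ⟨α, hα⟩ := hX x y
  exact ⟨_, subset_univ _, hα.left_mem_image, hα.right_mem_image,
    hα.isPathConnected_image.isConnected.isPreconnected⟩

theorem IsGeodesicSpace.locallyPathConnectedSpace (hX : IsGeodesicSpace X) :
    LocallyPathConnectedSpace X :=
  .of_bases (fun _ => nhds_basis_ball) fun x _ => hX.isPathConnected_ball x

end GeodesicSpaces

theorem mainTheorem12_general {X : Type u} [MetricSpace X] [ProperSpace X] [PreconnectedSpace X]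
    [LocallyPathConnectedSpace X] :
    ∃ (V : Type u) (G : SimpleGraph V) (hG : G.Connected),
      IsRTree (MetricGraph G hG) ∧
      (∀ a : V, (G.neighborSet a).Finite) ∧
      ∀ (x₀ : X) (t₀ : MetricGraph G hG),
        Nonempty (SpaceOfEnds X x₀ ≃ₜ SpaceOfEnds (MetricGraph G hG) t₀) := by
  rcases isEmpty_or_nonempty X with hX | ⟨⟨o⟩⟩
  · let T := componentTree PUnit.unit.{u + 1}
    exact ⟨_, T.graph, T.graph_connected, T.isRTree,
      T.finite_neighborSet (finite_setOf_level_componentTree_eq _), fun x₀ => hX.elim x₀⟩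
  · have : ConnectedSpace X := ⟨⟨o⟩⟩
    have : PathConnectedSpace X := pathConnectedSpace_iff_connectedSpace.2 this
    let T := componentTree o
    refine ⟨_, T.graph, T.graph_connected, T.isRTree,
      T.finite_neighborSet (finite_setOf_level_componentTree_eq o), fun x₀ t₀ => ⟨?_⟩⟩
    exact (SpaceOfEnds.changeBaseHomeomorph x₀ o).trans
      (((componentTreeLabelling o).homeomorph T.componentLabelling).trans
        (SpaceOfEnds.changeBaseHomeomorph _ t₀))

theorem mainTheorem12 {X : Type u} [MetricSpace X] [ProperSpace X] (hX : IsGeodesicSpace X) :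
    ∃ (V : Type u) (G : SimpleGraph V) (hG : G.Connected),
      IsRTree (MetricGraph G hG) ∧
      (∀ a : V, (G.neighborSet a).Finite) ∧
      ∀ (x₀ : X) (t₀ : MetricGraph G hG),
        Nonempty (SpaceOfEnds X x₀ ≃ₜ SpaceOfEnds (MetricGraph G hG) t₀) := by
  have := hX.preconnectedSpace
  have := hX.locallyPathConnectedSpace
  exact mainTheorem12_general
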